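/- Setting. Let $\mathcal A$ be a finite set of $K$ actions, $\mathcal X$ a measurable space of contexts and $\mathcal F$ a finite set of (measurable) predictors $f:\mathcal X\times\mathcal A\to[0,1]$. In each round $t=1,2,\dots$ nature draws a context and a reward vector $(x_t,r_t)\in\mathcal X\times[0,1]^{\mathcal A}$ i.i.d. from an unknown distribution $\mathcal D$; the learner observes $x_t$, picks $a_t\in\mathcal A$ and observes only $r_t(a_t)$. Assume realizability: there is $f^*\in\mathcal F$ with $\mathbb E[r_t(a)\mid x_t]=f^*(x_t,a)$ for all $a\in\mathcal A$. For $f\in\mathcal F$ let $\pi_f$ be a (measurable) policy with $\pi_f(x)\in\arg\max_{a\in\mathcal A}f(x,a)$. The regret after $T$ rounds is $\sum_{t=1}^T\big(r_t(\pi_{f^*}(x_t))-r_t(a_t)\big)$. A least-squares oracle for $\mathcal F$ is a deterministic (measurable) map that sends every finite sequence $(x_1,a_1,y_1),\dots,(x_n,a_n,y_n)$ in $\mathcal X\times\mathcal A\times[0,1]$, including the empty one, to a minimizer of $\sum_{s=1}^n(f(x_s,a_s)-y_s)^2$ over $f\in\mathcal F$. Algorithm (FALCON). The inputs are integers $0=\tau_0<\tau_1<\tau_2<\cdots$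 (the epoch schedule) and $\delta\in(0,1)$. Epoch $m\ge1$ consists of the rounds $\tau_{m-1}+1,\dots,\tau_m$. At its start, put $\gamma_1=1$ and, for $m\ge2$, $\gamma_m=\frac1{30}\sqrt{K\tau_{m-1}/\log(|\mathcal F|\tau_{m-1}/\delta)}$, and call the oracle on the data $(x_t,a_t,r_t(a_t))$, $t\le\tau_{m-1}$, to obtain $\widehat f_m$. In each round $t$ of the epoch, let $\widehat a_t=\pi_{\widehat f_m}(x_t)$ and draw $a_t$ from the distribution $p_t$ with $$p_t(a)=\frac1{K+\gamma_m\big(\widehat f_m(x_t,\widehat a_t)-\widehat f_m(x_t,a)\big)}\quad(a\ne\widehat a_t),\qquad p_t(\widehat a_t)=1-\sum_{a\ne\widehat a_t}p_t(a).$$ Theorem. (1) For every $B$ there is a constant $C$, depending only on $B$, such that the following holds in every instance of the above setting in which the schedule satisfies $\tau_1\le B$ and $\tau_m\le2\tau_{m-1}$ for all $m>1$: for every $T\ge1$, with probability at least $1-\delta$, the regret of FALCON after $T$ rounds is at most $$C\sqrt{KT\log(|\mathcal F|T/\delta)}.$$ (2) For every epoch schedule and every $T\ge1$, FALCON makes exactly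 one oracle call per epoch: the number of calls over the first $T$ rounds is $\min\{m\in\mathbb N: T\le\tau_m\}$. In particular, the schedule $\tau_m=2^m$ ($m\ge1$), $\tau_0=0$, satisfies $\tau_m\le2\tau_{m-1}$ for $m>1$ and leads to $O(\log T)$ oracle calls over $T\ge2$ rounds, with an absolute constant. -/

import Mathlib

open MeasureTheory ProbabilityTheory

noncomputable section

namespace Falcon

/-- An observation: a context, the chosen action, and the observed reward of that action. -/
abbrev Datum (X A : Type*) : Type _ := X × A × unitInterval

/-- The empirical square loss of the predictor `f` on a finite data sequence. -/
def squareLoss {X A : Type*} (f : X → A → unitInterval) {n : ℕ} (d : Fin n → Datum X A) : ℝ :=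
  ∑ i, ((f (d i).1 (d i).2.1 : ℝ) - ((d i).2.2 : ℝ)) ^ 2

/-- A (deterministic) offline least-squares regression oracle for the finite class `F`: on every
finite data sequence it returns a member of `F` of least empirical square loss. Ties may be broken
in any measurable way. -/
structure IsLeastSquaresOracle {X A : Type*} [MeasurableSpace X] [MeasurableSpace A]
    (F : Finset (X → A → unitInterval)) (oracle : (n : ℕ) → (Fin n → Datum X A) → F) : Prop where
  isMin : ∀ (n : ℕ) (d : Fin n → Datum X A), ∀ g ∈ F,
    squareLoss (oracle n d : X → A → unitInterval) d ≤ squareLoss g d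
  measurable : ∀ (n : ℕ) (f : F), MeasurableSet {d : Fin n → Datum X A | oracle n d = f}

/-- `pol f` is a (measurable) reward-maximizing policy of `f`, for every `f ∈ F`. -/
structure IsGreedyPolicy {X A : Type*} [MeasurableSpace X] [MeasurableSpace A]
    (F : Finset (X → A → unitInterval)) (pol : F → X → A) : Prop where
  isMax : ∀ (f : F) (x : X) (a : A),
    (f : X → A → unitInterval) x a ≤ (f : X → A → unitInterval) x (pol f x)
  measurable : ∀ f : F, Measurable (pol f)

/-- An epoch schedule `0 = τ₀ < τ₁ < τ₂ < ⋯`. -/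
structure IsEpochSchedule (τ : ℕ → ℕ) : Prop where
  zero : τ 0 = 0
  strictMono : StrictMono τ

/-- The schedule `τ₀ = 0`, `τ_m = 2 ^ m` for `m ≥ 1`. -/
def doublingSchedule (m : ℕ) : ℕ := if m = 0 then 0 else 2 ^ m

/-- The learning rate of epoch `m ≥ 1`, for `K` actions and a class of `N` predictors. -/
def learningRate (K N : ℕ) (δ : ℝ) (τ : ℕ → ℕ) (m : ℕ) : ℝ :=
  if m = 1 then 1
  else (1 / 30) * √((K * τ (m - 1)) / Real.log (N * τ (m - 1) / δ))

/-- The probability of selecting action `a`, given the learning rate `γ`, the predicted rewards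
`v` of all actions and the greedy action `aHat`. -/
def selectProb {A : Type*} [Fintype A] [DecidableEq A] (γ : ℝ) (v : A → unitInterval)
    (aHat a : A) : ℝ :=
  if a = aHat then
    1 - ∑ b ∈ Finset.univ.erase aHat,
      1 / ((Fintype.card A : ℝ) + γ * ((v aHat : ℝ) - (v b : ℝ)))
  else 1 / ((Fintype.card A : ℝ) + γ * ((v aHat : ℝ) - (v a : ℝ)))

/-- The internal state of the algorithm in a given round: the current epoch, the predictor in use,
and the number of oracle calls made so far. -/
structure State {X A : Type*} (F : Finset (X → A → unitInterval)) where
  epoch : ℕ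
  predictor : F
  calls : ℕ

/-- `state oracle τ d t` is the state in which the algorithm plays after `t` completed rounds with
observations `d 0, …, d (t - 1)`. The first epoch opens with an oracle call on the empty data
sequence; when the last round of the current epoch has been completed, the next epoch opens with an
oracle call on all data observed so far; within an epoch, the state does not change. -/
def state {X A : Type*} {F : Finset (X → A → unitInterval)}
    (oracle : (n : ℕ) → (Fin n → Datum X A) → F) (τ : ℕ → ℕ) (d : ℕ → Datum X A) : ℕ → State F
  | 0 => { epoch := 1, predictor := oracle 0 (fun i => d i), calls := 1 }
  | t + 1 =>
    let s := state oracle τ d t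
    if t + 1 = τ s.epoch then
      { epoch := s.epoch + 1
        predictor := oracle (t + 1) (fun i => d i)
        calls := s.calls + 1 }
    else s

/-- The number of oracle calls made over the first `T` rounds. -/
def oracleCalls {X A : Type*} {F : Finset (X → A → unitInterval)}
    (oracle : (n : ℕ) → (Fin n → Datum X A) → F) (τ : ℕ → ℕ) (d : ℕ → Datum X A) : ℕ → ℕ
  | 0 => 0
  | t + 1 => (state oracle τ d t).calls

/-- The probability with which the algorithm selects `a` after `t` completed rounds with
observations `d 0, …, d (t - 1)`, when the new context is `x`. -/
def actionProb {X A : Type*} [Fintype A] [DecidableEq A] {F : Finset (X → A → unitInterval)}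
    (oracle : (n : ℕ) → (Fin n → Datum X A) → F) (pol : F → X → A) (τ : ℕ → ℕ) (δ : ℝ)
    (d : ℕ → Datum X A) (t : ℕ) (x : X) (a : A) : ℝ :=
  let s := state oracle τ d t
  selectProb (learningRate (Fintype.card A) F.card δ τ s.epoch)
    ((s.predictor : X → A → unitInterval) x) (pol s.predictor x) a

/-- The observations of the learner: contexts, actions and rewards of the chosen actions. -/
def observed {Ω X A : Type*} (x : ℕ → Ω → X) (r : ℕ → Ω → A → unitInterval) (a : ℕ → Ω → A)
    (ω : Ω) (t : ℕ) : Datum X A :=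
  (x t ω, a t ω, r t ω (a t ω))

/-- The sigma-algebra generated by the contexts, full reward vectors and actions of the first
`t` rounds. -/
abbrev history {Ω X A : Type*} [MeasurableSpace X] [MeasurableSpace A]
    (x : ℕ → Ω → X) (r : ℕ → Ω → A → unitInterval) (a : ℕ → Ω → A) (t : ℕ) : MeasurableSpace Ω :=
  ⨆ s : Fin t, MeasurableSpace.comap (fun ω => (x s ω, r s ω, a s ω)) inferInstance

/-- The random variables `x t`, `r t`, `a t` (context, reward vector and action of round `t + 1`)
on the probability space `(Ω, P)` are a run of the algorithm in the environment `D`: in each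
round nature draws the context and the reward vector from `D`, independently of the past, and then,
given the past, the context and the reward vector, the action is drawn from the distribution that
the algorithm computes from its past observations and the context. -/
structure IsRun {Ω X A : Type*} [MeasurableSpace Ω] [MeasurableSpace X] [Fintype A] [DecidableEq A]
    [MeasurableSpace A] {F : Finset (X → A → unitInterval)}
    (oracle : (n : ℕ) → (Fin n → Datum X A) → F) (pol : F → X → A) (τ : ℕ → ℕ) (δ : ℝ)
    (D : Measure (X × (A → unitInterval))) (P : Measure Ω)
    (x : ℕ → Ω → X) (r : ℕ → Ω → A → unitInterval) (a : ℕ → Ω → A) : Prop where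
  measurable_context : ∀ t, Measurable (x t)
  measurable_reward : ∀ t, Measurable (r t)
  measurable_action : ∀ t, Measurable (a t)
  law : ∀ t, P.map (fun ω => (x t ω, r t ω)) = D
  indep : ∀ t, Indep (MeasurableSpace.comap (fun ω => (x t ω, r t ω)) inferInstance)
    (history x r a t) P
  action : ∀ (t : ℕ) (b : A),
    P[(a t ⁻¹' {b}).indicator (fun _ => (1 : ℝ)) |
        history x r a t ⊔ MeasurableSpace.comap (fun ω => (x t ω, r t ω)) inferInstance]
      =ᵐ[P] fun ω => actionProb oracle pol τ δ (observed x r a ω) t (x t ω) b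

/-- The predictor `f` is the conditional mean reward of the environment `D`:
`E[r(a) | x] = f(x, a)` for every action `a`. -/
def Realizes {X A : Type*} [MeasurableSpace X] (D : Measure (X × (A → unitInterval)))
    (f : X → A → unitInterval) : Prop :=
  ∀ a : A, D[fun z => (z.2 a : ℝ) | MeasurableSpace.comap Prod.fst inferInstance]
    =ᵐ[D] fun z => (f z.1 a : ℝ)

/-- The empirical cumulative regret against the policy `π` after `T` rounds. -/
def regret {Ω X A : Type*} (π : X → A) (x : ℕ → Ω → X) (r : ℕ → Ω → A → unitInterval)
    (a : ℕ → Ω → A) (T : ℕ) (ω : Ω) : ℝ :=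
  ∑ t ∈ Finset.range T, ((r t ω (π (x t ω)) : ℝ) - (r t ω (a t ω) : ℝ))

end Falcon

end

/-! The selection rule has two properties. Under the predictor in use, its own regret is at most `K
/ γ`, since every non-greedy action contributes at most `1 / γ`; and `1 / p(a) ≤ K + γ · gap(a)`, so
an action is explored rarely only if it is predicted to be bad.

By realizability the excess square loss over `fStar` has mean equal to the squared distance to
`fStar`, and its second moment is bounded by that distance as well. A supermartingale bound and a
union bound over predictors and sample sizes then show that a least-squares minimizer has total
squared error `O(log (N n / δ))` under the `n` past exploration distributions, where `N = |F|`. By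
the second property and AM-GM, this error and the regret of a policy `q` as estimated in earlier
rounds bound the error in the value of `q`. Induction over rounds (`policyRegret_le_and_le`) closes
the loop: for every policy, estimated and true regret bound each other up to a factor 2 and an
additive `K / γ`.

Applied to the exploration policy itself, this gives expected regret at most `3 K / γ`
(`roundRegret_le`). By the doubling condition `K / γ` is of order `√(K log (N T / δ) / t)` after the
first epoch, and summation over `t` gives the rate. A second supermartingale passes from expected to
realized regret. The case `N = T = 1` is separate, because `log (1 / δ)` can then be arbitrarily
small.

The oracle count holds because the call counter and the epoch counter advance together. -/

set_option linter.unusedSectionVars false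

noncomputable section

namespace Falcon

/-! ### Epochs and oracle calls. -/

/-- The epoch in which the algorithm plays after `t` completed rounds. -/
def epochAt (τ : ℕ → ℕ) : ℕ → ℕ
  | 0 => 1
  | t + 1 => if t + 1 = τ (epochAt τ t) then epochAt τ t + 1 else epochAt τ t

/-- The number of rounds completed before the epoch of round `t` started. -/
def epochStart (τ : ℕ → ℕ) (t : ℕ) : ℕ := τ (epochAt τ t - 1)

section Epochs

variable {τ : ℕ → ℕ}

theorem one_le_epochAt (t : ℕ) : 1 ≤ epochAt τ t := by
  induction t with
  | zero => simp [epochAt]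
  | succ t ih => rw [epochAt]; split_ifs <;> omega

/-- The epoch advances only when `t + 1` hits `τ` exactly. No boundary is skipped because `t` grows
by one and `τ` increases strictly, so this invariant locates the epoch. -/
theorem epochStart_le_lt (hτ : IsEpochSchedule τ) (t : ℕ) :
    epochStart τ t ≤ t ∧ t < τ (epochAt τ t) := by
  induction t with
  | zero =>
    have := hτ.strictMono (show 0 < 1 by norm_num)
    simp only [epochStart, epochAt, Nat.sub_self, hτ.zero]
    rw [hτ.zero] at this
    exact ⟨le_rfl, this⟩
  | succ t ih =>
    simp only [epochStart, epochAt] at ih ⊢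
    split_ifs with h
    · rw [Nat.add_sub_cancel, ← h]
      refine ⟨le_rfl, ?_⟩
      have := hτ.strictMono (Nat.lt_succ_self (epochAt τ t))
      simp only [Nat.succ_eq_add_one] at this
      omega
    · exact ⟨by omega, by omega⟩

theorem epochStart_mono (hτ : IsEpochSchedule τ) {s t : ℕ} (h : s ≤ t) :
    epochStart τ s ≤ epochStart τ t := by
  have hs := epochStart_le_lt hτ s
  have ht := epochStart_le_lt hτ t
  apply hτ.strictMono.monotone
  by_contra! hlt
  have : τ (epochAt τ t) ≤ τ (epochAt τ s - 1) := hτ.strictMono.monotone (by omega)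
  have : epochStart τ s = τ (epochAt τ s - 1) := rfl
  omega

theorem epochStart_eq_zero_iff (hτ : IsEpochSchedule τ) (t : ℕ) :
    epochStart τ t = 0 ↔ epochAt τ t = 1 := by
  have h1 := one_le_epochAt (τ := τ) t
  constructor
  · intro h
    rw [epochStart, ← hτ.zero] at h
    have := hτ.strictMono.injective h
    omega
  · intro h
    rw [epochStart, h, Nat.sub_self, hτ.zero]

variable {X A : Type*} {F : Finset (X → A → unitInterval)}
  (oracle : (n : ℕ) → (Fin n → Datum X A) → F) (d : ℕ → Datum X A)

theorem state_epoch (t : ℕ) : (state oracle τ d t).epoch = epochAt τ t := by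
  induction t with
  | zero => rfl
  | succ t ih =>
    simp only [state, epochAt, ih]
    split_ifs <;> simp [ih]

theorem state_calls (t : ℕ) : (state oracle τ d t).calls = epochAt τ t := by
  induction t with
  | zero => rfl
  | succ t ih =>
    simp only [state, epochAt, state_epoch]
    split_ifs <;> simp [ih]

theorem state_predictor (hτ : IsEpochSchedule τ) (t : ℕ) :
    (state oracle τ d t).predictor = oracle (epochStart τ t) (fun i => d i) := by
  -- The type of the data depends on their number, so equal lengths have to be transported through
  -- the oracle.
  have key : ∀ m n : ℕ, m = n → oracle m (fun i => d i) = oracle n (fun i => d i) := by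
    rintro m _ rfl; rfl
  induction t with
  | zero => exact key _ _ (by simp [epochStart, epochAt, hτ.zero])
  | succ t ih =>
    simp only [state, state_epoch]
    split_ifs with h
    · exact key _ _ (by simp [epochStart, epochAt, ← h])
    · rw [ih]
      exact key _ _ (by simp [epochStart, epochAt, h])

theorem isLeast_oracleCalls (hτ : IsEpochSchedule τ) {T : ℕ} (hT : 1 ≤ T) :
    IsLeast {m : ℕ | T ≤ τ m} (oracleCalls oracle τ d T) := by
  -- Round `T` is played after `t = T - 1` completed rounds; an epoch that would open after round
  -- `T` is not counted.
  obtain ⟨t, rfl⟩ : ∃ t, T = t + 1 := ⟨T - 1, by omega⟩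
  have h := epochStart_le_lt hτ t
  have h1 := one_le_epochAt (τ := τ) t
  rw [oracleCalls, state_calls]
  refine ⟨h.2, fun m hm => ?_⟩
  by_contra! hlt
  have : τ m ≤ τ (epochAt τ t - 1) := hτ.strictMono.monotone (by omega)
  simp only [Set.mem_ofPred_eq] at hm
  simp only [epochStart] at h
  omega

end Epochs

theorem isEpochSchedule_doublingSchedule : IsEpochSchedule doublingSchedule where
  zero := rfl
  strictMono := by
    refine strictMono_nat_of_lt_succ fun n => ?_
    rcases Nat.eq_zero_or_pos n with rfl | hn
    · simp [doublingSchedule]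
    · have : 0 < 2 ^ n := by positivity
      simp only [doublingSchedule, hn.ne', if_false, Nat.succ_ne_zero, pow_succ]
      omega

theorem doublingSchedule_le {m : ℕ} (hm : 1 < m) :
    doublingSchedule m ≤ 2 * doublingSchedule (m - 1) := by
  obtain ⟨k, rfl⟩ : ∃ k, m = k + 2 := ⟨m - 2, by omega⟩
  simp only [doublingSchedule, show k + 2 - 1 = k + 1 by omega]
  simp [pow_succ]
  omega

/-- There are at most `Nat.log 2 T + 1` calls by minimality, and the `1` is absorbed because `log 2
≤ log T`. -/
theorem oracleCalls_doublingSchedule_le {X A : Type*} {F : Finset (X → A → unitInterval)}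
    (oracle : (n : ℕ) → (Fin n → Datum X A) → F) (d : ℕ → Datum X A) {T : ℕ} (hT : 2 ≤ T) :
    (oracleCalls oracle doublingSchedule d T : ℝ) ≤ 2 / Real.log 2 * Real.log T := by
  have hle : oracleCalls oracle doublingSchedule d T ≤ Nat.log 2 T + 1 := by
    apply (isLeast_oracleCalls oracle d isEpochSchedule_doublingSchedule (by omega)).2
    simpa [doublingSchedule] using (Nat.lt_pow_succ_log_self (by norm_num) T).le
  have h2 : 0 < Real.log 2 := Real.log_pos (by norm_num)
  have hlog : (Nat.log 2 T : ℝ) * Real.log 2 ≤ Real.log T := by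
    rw [← Real.log_pow]
    apply Real.log_le_log (by positivity)
    exact_mod_cast Nat.pow_log_le_self 2 (by omega)
  have hlog' : Real.log 2 ≤ Real.log T := Real.log_le_log (by norm_num) (by exact_mod_cast hT)
  have : (oracleCalls oracle doublingSchedule d T : ℝ) ≤ Nat.log 2 T + 1 := by exact_mod_cast hle
  rw [div_mul_eq_mul_div, le_div_iff₀ h2]
  nlinarith

/-! ### Inverse gap weighting. -/

section SelectProb

variable {A : Type*} [Fintype A] [DecidableEq A] {γ : ℝ} {v : A → unitInterval} {p : A}

theorem selectProb_denominator_ge (hγ : 0 ≤ γ) (hp : ∀ b, v b ≤ v p) (b : A) :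
    (Fintype.card A : ℝ) ≤ (Fintype.card A : ℝ) + γ * ((v p : ℝ) - v b) := by
  have : (v b : ℝ) ≤ v p := hp b
  nlinarith [mul_nonneg hγ (sub_nonneg.2 this)]

theorem card_pos_of_mem (p : A) : (0 : ℝ) < Fintype.card A := by
  exact_mod_cast Fintype.card_pos_iff.2 ⟨p⟩

theorem sum_selectProb (γ : ℝ) (v : A → unitInterval) (p : A) : ∑ b, selectProb γ v p b = 1 := by
  rw [← Finset.add_sum_erase _ _ (Finset.mem_univ p)]
  have : ∀ b ∈ Finset.univ.erase p, selectProb γ v p b =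
      1 / ((Fintype.card A : ℝ) + γ * ((v p : ℝ) - (v b : ℝ))) := by
    intro b hb
    rw [selectProb, if_neg (Finset.ne_of_mem_erase hb)]
  rw [Finset.sum_congr rfl this, selectProb, if_pos rfl]
  ring

/-- Each of the `K - 1` other actions gets at most `1 / K`, which leaves at least `1 / K`. -/
theorem inv_card_le_selectProb_self (hγ : 0 ≤ γ) (hp : ∀ b, v b ≤ v p) :
    1 / (Fintype.card A : ℝ) ≤ selectProb γ v p p := by
  have hK := card_pos_of_mem p
  rw [selectProb, if_pos rfl]
  have h : ∑ b ∈ Finset.univ.erase p, 1 / ((Fintype.card A : ℝ) + γ * ((v p : ℝ) - (v b : ℝ)))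
      ≤ ∑ b ∈ Finset.univ.erase p, 1 / (Fintype.card A : ℝ) :=
    Finset.sum_le_sum fun b _ =>
      one_div_le_one_div_of_le hK (selectProb_denominator_ge hγ hp b)
  have h2 : ∑ b ∈ Finset.univ.erase p, 1 / (Fintype.card A : ℝ) + 1 / (Fintype.card A : ℝ) = 1 := by
    rw [Finset.sum_erase_add _ _ (Finset.mem_univ p)]
    simp [hK.ne']
  linarith

theorem selectProb_pos (hγ : 0 ≤ γ) (hp : ∀ b, v b ≤ v p) (b : A) : 0 < selectProb γ v p b := by
  have hK := card_pos_of_mem p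
  by_cases h : b = p
  · subst h
    exact (one_div_pos.2 hK).trans_le (inv_card_le_selectProb_self hγ hp)
  · rw [selectProb, if_neg h]
    exact one_div_pos.2 (hK.trans_le (selectProb_denominator_ge hγ hp b))

/-- This bounds the importance weight `1 / p(b)` by an affine function of the predicted gap, with
equality off the greedy action. -/
theorem one_le_selectProb_mul (hγ : 0 ≤ γ) (hp : ∀ b, v b ≤ v p) (b : A) :
    1 ≤ selectProb γ v p b * (Fintype.card A + γ * ((v p : ℝ) - v b)) := by
  have hK := card_pos_of_mem p
  by_cases h : b = p
  · subst h
    have := inv_card_le_selectProb_self hγ hp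
    rw [div_le_iff₀ hK] at this
    simpa using this
  · have := hK.trans_le (selectProb_denominator_ge hγ hp b)
    rw [selectProb, if_neg h, one_div_mul_cancel this.ne']

/-- Each term is zero or of the form `x / (K + γ x) ≤ 1 / γ`, and there are `K` terms. -/
theorem sum_selectProb_mul_gap_le (hγ : 0 < γ) (hp : ∀ b, v b ≤ v p) :
    ∑ b, selectProb γ v p b * ((v p : ℝ) - v b) ≤ Fintype.card A / γ := by
  have hK := card_pos_of_mem p
  have : ∀ b ∈ (Finset.univ : Finset A), selectProb γ v p b * ((v p : ℝ) - v b) ≤ 1 / γ := by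
    intro b _
    by_cases h : b = p
    · subst h; simp [hγ.le]
    · have hd := hK.trans_le (selectProb_denominator_ge hγ.le hp b)
      rw [selectProb, if_neg h, one_div_mul_eq_div, div_le_div_iff₀ hd hγ]
      linarith
  refine (Finset.sum_le_sum this).trans_eq ?_
  simp [div_eq_mul_inv]

end SelectProb

/-! ### Stochastic policies, their values and regrets. -/

variable {Z : Type*} [MeasurableSpace Z] {A : Type*} [Fintype A] [DecidableEq A]

/-- A stochastic policy: for every context a probability vector over the actions. -/
structure IsStochasticPolicy (q : Z → A → ℝ) : Prop where
  measurable : ∀ b, Measurable fun z => q z b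
  nonneg : ∀ z b, 0 ≤ q z b
  sum_eq_one : ∀ z, ∑ b, q z b = 1

theorem IsStochasticPolicy.le_one {q : Z → A → ℝ} (hq : IsStochasticPolicy q) (z : Z) (b : A) :
    q z b ≤ 1 := by
  rw [← hq.sum_eq_one z]
  exact Finset.single_le_sum (fun c _ => hq.nonneg z c) (Finset.mem_univ b)

/-- The stochastic policy that plays according to `p`. -/
def pointPolicy (p : Z → A) (z : Z) (b : A) : ℝ := if b = p z then 1 else 0

theorem isStochasticPolicy_pointPolicy [MeasurableSpace A] [MeasurableSingletonClass A] {p : Z → A}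
    (hp : Measurable p) : IsStochasticPolicy (pointPolicy p) where
  measurable b := by
    refine Measurable.ite ?_ measurable_const measurable_const
    simpa [Set.preimage, eq_comm] using hp (measurableSet_singleton b)
  nonneg z b := by unfold pointPolicy; split_ifs <;> norm_num
  sum_eq_one z := by simp [pointPolicy]

/-- The measurability and optimality of a greedy policy `p` for the predictor `v`. -/
structure IsGreedy [MeasurableSpace A] (v : Z → A → unitInterval) (p : Z → A) : Prop where
  measurable_predictor : ∀ b, Measurable fun z => v z b
  measurable : Measurable p
  isMax : ∀ z b, v z b ≤ v z (p z)

theorem measurable_eval {Y : Type*} [MeasurableSpace Y] [MeasurableSpace A]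
    [MeasurableSingletonClass A] {u : Z → A → Y} (hu : ∀ b, Measurable fun z => u z b)
    {p : Z → A} (hp : Measurable p) : Measurable fun z => u z (p z) := by
  have : Measurable fun y : Z × A => u y.1 y.2 := measurable_from_prod_countable_left hu
  exact this.comp (measurable_id.prodMk hp)

theorem isStochasticPolicy_selectProb [MeasurableSpace A] [MeasurableSingletonClass A]
    {v : Z → A → unitInterval} {p : Z → A} (h : IsGreedy v p) {γ : ℝ} (hγ : 0 ≤ γ) :
    IsStochasticPolicy fun z => selectProb γ (v z) (p z) where
  measurable b := by
    have h1 : ∀ b, Measurable fun z => (v z b : ℝ) := fun b =>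
      measurable_subtype_coe.comp (h.measurable_predictor b)
    have h3 : Measurable fun y : Z × A => selectProb γ (v y.1) y.2 b := by
      refine measurable_from_prod_countable_left fun c => ?_
      by_cases hc : b = c
      · simp only [selectProb, hc, if_true]
        fun_prop
      · simp only [selectProb, hc, if_false]
        fun_prop
    exact h3.comp (measurable_id.prodMk h.measurable)
  nonneg z b := (selectProb_pos hγ (h.isMax z) b).le
  sum_eq_one z := sum_selectProb _ _ _

/-- The expected value of the policy `q` if `v` gives the rewards. -/
def policyValue (ν : Measure Z) (v : Z → A → unitInterval) (q : Z → A → ℝ) : ℝ :=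
  ∫ z, ∑ b, q z b * v z b ∂ν

/-- The expected squared distance of the predictors `v` and `w` when actions are drawn from `q`. -/
def sqDist (ν : Measure Z) (v w : Z → A → unitInterval) (q : Z → A → ℝ) : ℝ :=
  ∫ z, ∑ b, q z b * ((v z b : ℝ) - w z b) ^ 2 ∂ν

/-- The expected regret of the policy `q` against the policy `p` if `v` gives the rewards. -/
def policyRegret (ν : Measure Z) (v : Z → A → unitInterval) (p : Z → A) (q : Z → A → ℝ) : ℝ :=
  policyValue ν v (pointPolicy p) - policyValue ν v q

variable {ν : Measure Z} [IsProbabilityMeasure ν]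

theorem integrable_of_abs_le {Y : Type*} [MeasurableSpace Y] {μ : Measure Y} [IsFiniteMeasure μ]
    {u : Y → ℝ} (hu : Measurable u) (c : ℝ) (h : ∀ y, |u y| ≤ c) : Integrable u μ :=
  Integrable.of_bound hu.aestronglyMeasurable c (Filter.Eventually.of_forall h)

theorem integrable_sum_mul {q : Z → A → ℝ} (hq : IsStochasticPolicy q) {u : Z → A → ℝ}
    (hu : ∀ b, Measurable fun z => u z b) (c : ℝ) (h : ∀ z b, |u z b| ≤ c) :
    Integrable (fun z => ∑ b, q z b * u z b) ν := by
  refine integrable_finsetSum _ fun b _ => integrable_of_abs_le ((hq.measurable b).mul (hu b)) c ?_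
  intro z
  rw [abs_mul, abs_of_nonneg (hq.nonneg z b)]
  have := hq.le_one z b
  have := hq.nonneg z b
  have := h z b
  nlinarith [abs_nonneg (u z b)]

theorem abs_sum_mul_le {q : Z → A → ℝ} (hq : IsStochasticPolicy q) {u : A → ℝ} (z : Z) {c : ℝ}
    (h : ∀ b, |u b| ≤ c) : |∑ b, q z b * u b| ≤ c := by
  calc |∑ b, q z b * u b| ≤ ∑ b, q z b * c := by
        refine (Finset.abs_sum_le_sum_abs _ _).trans (Finset.sum_le_sum fun b _ => ?_)
        rw [abs_mul, abs_of_nonneg (hq.nonneg z b)]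
        exact mul_le_mul_of_nonneg_left (h b) (hq.nonneg z b)
    _ = c := by rw [← Finset.sum_mul, hq.sum_eq_one, one_mul]

theorem abs_unitInterval_le (y : unitInterval) : |(y : ℝ)| ≤ 1 := by
  rw [abs_of_nonneg y.2.1]; exact y.2.2

theorem abs_sub_unitInterval_le (y z : unitInterval) : |(y : ℝ) - z| ≤ 1 := by
  rw [abs_le]
  constructor <;> linarith [y.2.1, y.2.2, z.2.1, z.2.2]

theorem integrable_policyValue {q : Z → A → ℝ} (hq : IsStochasticPolicy q)
    {v : Z → A → unitInterval} (hv : ∀ b, Measurable fun z => v z b) :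
    Integrable (fun z => ∑ b, q z b * (v z b : ℝ)) ν :=
  integrable_sum_mul hq (fun b => measurable_subtype_coe.comp (hv b)) 1
    fun _ _ => abs_unitInterval_le _

theorem integrable_sqDist {q : Z → A → ℝ} (hq : IsStochasticPolicy q)
    {v w : Z → A → unitInterval} (hv : ∀ b, Measurable fun z => v z b)
    (hw : ∀ b, Measurable fun z => w z b) :
    Integrable (fun z => ∑ b, q z b * ((v z b : ℝ) - w z b) ^ 2) ν := by
  refine integrable_sum_mul hq (fun b => ?_) 1 fun z b => ?_
  · have h1 := measurable_subtype_coe.comp (hv b)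
    have h2 := measurable_subtype_coe.comp (hw b)
    exact (h1.sub h2).pow_const 2
  · rw [abs_pow]
    exact pow_le_one₀ (abs_nonneg _) (abs_sub_unitInterval_le _ _)

theorem sum_pointPolicy_mul (p : Z → A) (z : Z) (u : A → ℝ) :
    ∑ b, pointPolicy p z b * u b = u (p z) := by
  simp [pointPolicy]

theorem sqDist_comm (v w : Z → A → unitInterval) (q : Z → A → ℝ) :
    sqDist ν v w q = sqDist ν w v q := by
  unfold sqDist
  congr 1 with z
  exact Finset.sum_congr rfl fun b _ => by ring

section

variable [MeasurableSpace A] [MeasurableSingletonClass A]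
  {v w u : Z → A → unitInterval} {p : Z → A} {q : Z → A → ℝ}

theorem policyRegret_eq_integral (h : IsGreedy v p) (hq : IsStochasticPolicy q) :
    policyRegret ν v p q = ∫ z, ∑ b, q z b * ((v z (p z) : ℝ) - v z b) ∂ν := by
  rw [policyRegret, policyValue, policyValue, ← integral_sub
    (integrable_policyValue (isStochasticPolicy_pointPolicy h.measurable) h.measurable_predictor)
    (integrable_policyValue hq h.measurable_predictor)]
  congr 1 with z
  rw [sum_pointPolicy_mul]
  simp_rw [mul_sub]
  rw [Finset.sum_sub_distrib, ← Finset.sum_mul, hq.sum_eq_one, one_mul]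

theorem policyRegret_nonneg (h : IsGreedy v p) (hq : IsStochasticPolicy q) :
    0 ≤ policyRegret ν v p q := by
  rw [policyRegret_eq_integral h hq]
  refine integral_nonneg fun z => Finset.sum_nonneg fun b _ => mul_nonneg (hq.nonneg z b) ?_
  exact sub_nonneg.2 (h.isMax z b)

theorem policyRegret_le_one (h : IsGreedy v p) (hq : IsStochasticPolicy q) :
    policyRegret ν v p q ≤ 1 := by
  rw [policyRegret_eq_integral h hq]
  calc _ ≤ ∫ _, (1 : ℝ) ∂ν := by
        refine integral_mono_of_nonneg (Filter.Eventually.of_forall fun z => ?_)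
          (integrable_const _) (Filter.Eventually.of_forall fun z => ?_)
        · exact Finset.sum_nonneg fun b _ =>
            mul_nonneg (hq.nonneg z b) (sub_nonneg.2 (h.isMax z b))
        · exact (le_abs_self _).trans (abs_sum_mul_le hq z fun b => abs_sub_unitInterval_le _ _)
    _ = 1 := by simp

theorem policyRegret_selectProb_le (h : IsGreedy v p) {γ : ℝ} (hγ : 0 < γ) :
    policyRegret ν v p (fun z => selectProb γ (v z) (p z)) ≤ Fintype.card A / γ := by
  have hq := isStochasticPolicy_selectProb h hγ.le
  rw [policyRegret_eq_integral h hq]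
  calc _ ≤ ∫ _, (Fintype.card A / γ : ℝ) ∂ν := by
        refine integral_mono_of_nonneg (Filter.Eventually.of_forall fun z => ?_)
          (integrable_const _) (Filter.Eventually.of_forall fun z => ?_)
        · exact Finset.sum_nonneg fun b _ =>
            mul_nonneg (hq.nonneg z b) (sub_nonneg.2 (h.isMax z b))
        · exact sum_selectProb_mul_gap_le hγ (h.isMax z)
    _ = _ := by simp

/-- Change of measure: the error of a predictor under a policy `q` is controlled by its squared
error under the exploration policy and by the regret of `q` estimated in that round. -/
theorem policyValue_sub_le (hu : IsGreedy u p) (hv : ∀ b, Measurable fun z => v z b)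
    (hw : ∀ b, Measurable fun z => w z b) (hq : IsStochasticPolicy q) {γ η : ℝ} (hγ : 0 ≤ γ)
    (hη : 0 < η) :
    policyValue ν v q - policyValue ν w q ≤
      η / 2 * (Fintype.card A + γ * policyRegret ν u p q)
        + 1 / (2 * η) * sqDist ν v w (fun z => selectProb γ (u z) (p z)) := by
  have hQ := isStochasticPolicy_selectProb hu hγ
  have i1 : Integrable (fun z => ∑ b, q z b * ((u z (p z) : ℝ) - u z b)) ν := by
    refine integrable_sum_mul hq (fun b => ?_) 1 fun z b => abs_sub_unitInterval_le _ _
    exact (measurable_subtype_coe.comp (measurable_eval hu.measurable_predictor hu.measurable)).sub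
      (measurable_subtype_coe.comp (hu.measurable_predictor b))
  have i2 := integrable_sqDist (ν := ν) hQ hv hw
  rw [policyRegret_eq_integral hu hq, policyValue, policyValue, sqDist,
    ← integral_sub (integrable_policyValue hq hv) (integrable_policyValue hq hw)]
  calc _ ≤ ∫ z, (η / 2 * (Fintype.card A + γ * ∑ b, q z b * ((u z (p z) : ℝ) - u z b))
        + 1 / (2 * η) * ∑ b, selectProb γ (u z) (p z) b * ((v z b : ℝ) - w z b) ^ 2) ∂ν := ?_
    _ = _ := by
      have i3 : Integrable (fun z => (Fintype.card A : ℝ) +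
          γ * ∑ b, q z b * ((u z (p z) : ℝ) - u z b)) ν := (integrable_const _).add (i1.const_mul _)
      rw [integral_add (i3.const_mul _) (i2.const_mul _), integral_const_mul, integral_const_mul,
        integral_add (integrable_const _) (i1.const_mul _), integral_const_mul]
      simp
  refine integral_mono ((integrable_policyValue hq hv).sub (integrable_policyValue hq hw))
    ((((integrable_const _).add (i1.const_mul _)).const_mul _).add (i2.const_mul _)) fun z => ?_
  -- Spreading `K` over the actions with weights `q z b` reduces the claim to a comparison action by
  -- action.
  have e : (Fintype.card A : ℝ) = ∑ b, q z b * Fintype.card A := by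
    rw [← Finset.sum_mul, hq.sum_eq_one, one_mul]
  dsimp only
  rw [← Finset.sum_sub_distrib]
  nth_rewrite 1 [e]
  rw [Finset.mul_sum, ← Finset.sum_add_distrib, Finset.mul_sum, Finset.mul_sum,
    ← Finset.sum_add_distrib]
  refine Finset.sum_le_sum fun b _ => ?_
  have h0 := hq.nonneg z b
  have h1 := hq.le_one z b
  have hQ0 := selectProb_pos hγ (hu.isMax z) b
  have hQ1 := one_le_selectProb_mul hγ (hu.isMax z) b
  set Q := selectProb γ (u z) (p z) b
  set S := (Fintype.card A : ℝ) + γ * ((u z (p z) : ℝ) - u z b)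
  set g := (v z b : ℝ) - w z b
  have hS : 1 / Q ≤ S := by rw [div_le_iff₀ hQ0]; linarith
  -- AM-GM with weight `η`: the defect is a perfect square.
  have key : q z b * g ≤ η / 2 * (q z b ^ 2 * (1 / Q)) + 1 / (2 * η) * (Q * g ^ 2) := by
    have : η / 2 * (q z b ^ 2 * (1 / Q)) + 1 / (2 * η) * (Q * g ^ 2) - q z b * g =
        (η * q z b - Q * g) ^ 2 / (2 * η * Q) := by
      field_simp; ring
    have : 0 ≤ (η * q z b - Q * g) ^ 2 / (2 * η * Q) := by positivity
    linarith
  -- Here `q ^ 2 ≤ q` and `1 / Q ≤ S`, so averaging over `q` gives `K + γ` times the estimated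
  -- regret.
  have h2 : q z b ^ 2 * (1 / Q) ≤ q z b * S := by
    have : 0 < 1 / Q := by positivity
    have hS0 : 0 ≤ S := this.le.trans hS
    calc q z b ^ 2 * (1 / Q) ≤ q z b ^ 2 * S := by gcongr
      _ ≤ q z b * S := by
        apply mul_le_mul_of_nonneg_right _ hS0
        nlinarith
  have h3 : η / 2 * (q z b ^ 2 * (1 / Q)) ≤ η / 2 * (q z b * S) := by gcongr
  have e2 : q z b * (v z b : ℝ) - q z b * w z b = q z b * g := by simp only [g]; ring
  have e3 : q z b * (Fintype.card A : ℝ) + γ * (q z b * ((u z (p z) : ℝ) - u z b)) = q z b * S := by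
    simp only [S]; ring
  rw [e2, e3]
  exact key.trans (by linarith)

end

/-! ### Comparison of estimated and true regret. -/

section Induction

variable [MeasurableSpace A] [MeasurableSingletonClass A]
  {v : ℕ → Z → A → unitInterval} {p : ℕ → Z → A} {γ : ℕ → ℝ} {start : ℕ → ℕ}
  {w : Z → A → unitInterval} {pw : Z → A} {q : Z → A → ℝ}

/-- Averages `policyValue_sub_le` over the past rounds `s < n`. With `η = 1 / (4 g)` the regret term
gives `(K + V) / (8 g)` and the squared error gives `K / (8 g)`. Exchanging `u` and `w` gives the
other sign. -/
theorem abs_policyValue_sub_le (h : ∀ t, IsGreedy (v t) (p t)) (hγ : ∀ t, 0 < γ t)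
    {u : Z → A → unitInterval} (hu : ∀ b, Measurable fun z => u z b)
    (hw : ∀ b, Measurable fun z => w z b)
    (hq : IsStochasticPolicy q) {n : ℕ} (hn : 0 < n) {g V : ℝ} (hg : 0 < g)
    (herr : ∑ s ∈ Finset.range n, sqDist ν u w (fun z => selectProb (γ s) (v s z) (p s z))
      ≤ Fintype.card A * n / (16 * g ^ 2))
    (hV : ∀ s < n, γ s * policyRegret ν (v s) (p s) q ≤ V) :
    |policyValue ν u q - policyValue ν w q| ≤ (2 * Fintype.card A + V) / (8 * g) := by
  have hn' : (0 : ℝ) < n := by exact_mod_cast hn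
  have hη : 0 < 1 / (4 * g) := by positivity
  have main : ∀ y : ℝ, (∀ s < n, y ≤ 1 / (4 * g) / 2 * (Fintype.card A +
      γ s * policyRegret ν (v s) (p s) q) + 1 / (2 * (1 / (4 * g))) *
      sqDist ν u w (fun z => selectProb (γ s) (v s z) (p s z))) →
      y ≤ (2 * Fintype.card A + V) / (8 * g) := by
    intro y hy
    have h1 : ∑ s ∈ Finset.range n, y ≤ ∑ s ∈ Finset.range n,
        (1 / (8 * g) * (Fintype.card A + V) + 2 * g *
          sqDist ν u w (fun z => selectProb (γ s) (v s z) (p s z))) := by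
      refine Finset.sum_le_sum fun s hs => ?_
      have hs' := Finset.mem_range.1 hs
      have e1 : 1 / (4 * g) / 2 = 1 / (8 * g) := by field_simp; norm_num
      have e2 : 1 / (2 * (1 / (4 * g))) = 2 * g := by field_simp; norm_num
      have h2 := hy s hs'
      rw [e1, e2] at h2
      have h3 := hV s hs'
      have : 1 / (8 * g) * (Fintype.card A + γ s * policyRegret ν (v s) (p s) q)
          ≤ 1 / (8 * g) * (Fintype.card A + V) := by gcongr
      linarith
    rw [Finset.sum_add_distrib, Finset.sum_const, Finset.sum_const, Finset.card_range,
      nsmul_eq_mul, nsmul_eq_mul, ← Finset.mul_sum] at h1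
    have h2 := mul_le_mul_of_nonneg_left herr (by positivity : 0 ≤ 2 * g)
    have h3 : 2 * g * (Fintype.card A * n / (16 * g ^ 2)) = n * (Fintype.card A / (8 * g)) := by
      field_simp; ring
    have h4 : (n : ℝ) * y ≤ n * ((2 * Fintype.card A + V) / (8 * g)) := by
      have e : (n : ℝ) * ((2 * Fintype.card A + V) / (8 * g)) =
        n * (1 / (8 * g) * (Fintype.card A + V)) + n * (Fintype.card A / (8 * g)) := by
        field_simp; ring
      rw [e]; linarith
    exact le_of_mul_le_mul_left h4 hn'
  rw [abs_le']
  constructor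
  · exact main _ fun s _ => policyValue_sub_le (h s) hu hw hq (hγ s).le hη
  · rw [neg_sub]
    refine main _ fun s _ => ?_
    rw [sqDist_comm]
    exact policyValue_sub_le (h s) hw hu hq (hγ s).le hη

/-- If every predictor is accurate on the past exploration distributions, then estimated and true
regrets of all policies agree up to a factor and the exploration cost. -/
theorem policyRegret_le_and_le (h : ∀ t, IsGreedy (v t) (p t)) (hw : IsGreedy w pw)
    (hγ : ∀ t, 0 < γ t) (hstart : ∀ t, start t ≤ t) (hone : ∀ t, start t = 0 → γ t = 1)
    (hmono : ∀ s t, s < start t → start s ≠ 0 → γ s ≤ γ t) {T : ℕ}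
    (herr : ∀ t < T, 0 < start t →
      ∑ s ∈ Finset.range (start t), sqDist ν (v t) w (fun z => selectProb (γ s) (v s z) (p s z))
        ≤ Fintype.card A * start t / (16 * γ t ^ 2)) (t : ℕ) (ht : t < T) :
    ∀ q : Z → A → ℝ, IsStochasticPolicy q →
      policyRegret ν w pw q ≤ 2 * policyRegret ν (v t) (p t) q + Fintype.card A / γ t ∧
      policyRegret ν (v t) (p t) q ≤ 2 * policyRegret ν w pw q + Fintype.card A / γ t := by
  induction t using Nat.strong_induction_on with
  | _ t ih =>
  have hone_le : ∀ q : Z → A → ℝ, IsStochasticPolicy q → (1 : ℝ) ≤ Fintype.card A := by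
    intro q hq
    obtain ⟨z⟩ : Nonempty Z := nonempty_of_isProbabilityMeasure ν
    exact_mod_cast Fintype.card_pos_iff.2 ⟨pw z⟩
  intro q hq
  have hK := hone_le q hq
  -- In the first epoch `γ = 1`, and regrets lie in `[0, 1]` while `K / γ = K ≥ 1`.
  rcases Nat.eq_zero_or_pos (start t) with h0 | h0
  · rw [hone t h0, div_one]
    have h1 := policyRegret_le_one (ν := ν) hw hq
    have h2 := policyRegret_nonneg (ν := ν) hw hq
    have h3 := policyRegret_le_one (ν := ν) (h t) hq
    have h4 := policyRegret_nonneg (ν := ν) (h t) hq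
    constructor <;> linarith
  have hg := hγ t
  -- The induction hypothesis at `s` turns past estimated regret into true regret, and `γ s ≤ γ t`
  -- makes the bound uniform in `s`. First-epoch rounds are treated directly, since `γ = 1` there
  -- need not lie below `γ t`.
  have hV : ∀ q : Z → A → ℝ, IsStochasticPolicy q → ∀ s < start t,
      γ s * policyRegret ν (v s) (p s) q ≤ Fintype.card A + 2 * (γ t * policyRegret ν w pw q) := by
    intro q hq s hs
    have hst : s < t := hs.trans_le (hstart t)
    have hR := policyRegret_nonneg (ν := ν) hw hq
    by_cases hs0 : start s = 0
    · rw [hone s hs0, one_mul]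
      have := policyRegret_le_one (ν := ν) (h s) hq
      have := mul_nonneg hg.le hR
      linarith
    · have h1 := (ih s hst (hst.trans ht) q hq).2
      have h2 := mul_le_mul_of_nonneg_left h1 (hγ s).le
      have h3 : γ s * (2 * policyRegret ν w pw q + Fintype.card A / γ s) =
          Fintype.card A + 2 * (γ s * policyRegret ν w pw q) := by
        have := (hγ s).ne'
        field_simp; ring
      have h4 := mul_le_mul_of_nonneg_right (hmono s t hs hs0) hR
      linarith
  have hΔ := fun (q : Z → A → ℝ) (hq : IsStochasticPolicy q) =>
    abs_policyValue_sub_le h hγ (h t).measurable_predictor hw.measurable_predictor hq h0 hg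
      (herr t ht h0) (hV q hq)
  have hpw := isStochasticPolicy_pointPolicy (p := pw) hw.measurable
  have hpt := isStochasticPolicy_pointPolicy (p := p t) (h t).measurable
  -- The value error is at most `3/8 · K/γ + R(q)/4` at `q` and `3/8 · K/γ` at the optimal policy.
  -- Hence `3/4 · R(q)` is at most the estimated regret plus `3/4 · K/γ`.
  have first : ∀ q : Z → A → ℝ, IsStochasticPolicy q →
      policyRegret ν w pw q ≤ 2 * policyRegret ν (v t) (p t) q + Fintype.card A / γ t := by
    intro q hq
    have d1 := abs_le.1 (hΔ q hq)
    have d2 := abs_le.1 (hΔ _ hpw)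
    have r0 : policyRegret ν w pw (pointPolicy pw) = 0 := sub_self _
    rw [r0] at d2
    have opt := policyRegret_nonneg (ν := ν) (h t) hpw
    have pos := policyRegret_nonneg (ν := ν) (h t) hq
    have e1 : (2 * Fintype.card A + (Fintype.card A + 2 * (γ t * policyRegret ν w pw q))) /
        (8 * γ t) = 3 / 8 * (Fintype.card A / γ t) + policyRegret ν w pw q / 4 := by
      field_simp; ring
    have e2 : (2 * Fintype.card A + (Fintype.card A + 2 * (γ t * 0))) / (8 * γ t) =
        3 / 8 * (Fintype.card A / γ t) := by
      field_simp; ring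
    rw [e1] at d1
    rw [e2] at d2
    have k : policyRegret ν w pw q = policyRegret ν (v t) (p t) q
      - policyRegret ν (v t) (p t) (pointPolicy pw)
      + (policyValue ν (v t) q - policyValue ν w q)
      - (policyValue ν (v t) (pointPolicy pw) - policyValue ν w (pointPolicy pw)) := by
      unfold policyRegret; ring
    linarith [d1.2, d2.1]
  refine ⟨first q hq, ?_⟩
  have d1 := abs_le.1 (hΔ q hq)
  have d2 := abs_le.1 (hΔ _ hpt)
  have r0 : policyRegret ν (v t) (p t) (pointPolicy (p t)) = 0 := sub_self _
  have r1 := first _ hpt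
  rw [r0, mul_zero, zero_add] at r1
  have opt := policyRegret_nonneg (ν := ν) hw hpt
  have pos := policyRegret_nonneg (ν := ν) hw hq
  have e1 : ∀ x : ℝ, (2 * Fintype.card A + (Fintype.card A + 2 * (γ t * x))) /
      (8 * γ t) = 3 / 8 * (Fintype.card A / γ t) + x / 4 := by
    intro x
    field_simp; ring
  rw [e1] at d1 d2
  have k : policyRegret ν (v t) (p t) q = policyRegret ν w pw q
    - policyRegret ν w pw (pointPolicy (p t))
    - (policyValue ν (v t) q - policyValue ν w q)
    + (policyValue ν (v t) (pointPolicy (p t)) - policyValue ν w (pointPolicy (p t))) := by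
    unfold policyRegret; ring
  linarith [d1.1, d2.2]

end Induction

/-! ### Averaging over one round. -/

section Round

variable {Ω E A : Type*} {H : MeasurableSpace Ω} [mΩ : MeasurableSpace Ω]
  [MeasurableSpace E] [Fintype A] [DecidableEq A]
  [MeasurableSpace A] [MeasurableSingletonClass A]

/-- Averaging over one round: the fresh variable `z` has law `D` and is independent of the past
`H`, and the action is drawn from `p z` given the past and `z`, on the event that `Y ≠ 0`. -/
theorem integral_mul_round {P : Measure Ω} [IsProbabilityMeasure P] {D : Measure E}
    (hH : H ≤ mΩ) {z : Ω → E} (hz : Measurable z) (hlaw : P.map z = D)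
    (hind : Indep (MeasurableSpace.comap z inferInstance) H P) {a : Ω → A} (ha : Measurable a)
    {p : E → A → ℝ} (hp : IsStochasticPolicy p) {Y : Ω → ℝ} (hY : Measurable[H] Y) {c : ℝ}
    (hYc : ∀ ω, |Y ω| ≤ c)
    (hact : ∀ b, ∀ᵐ ω ∂P, Y ω ≠ 0 → (P[(a ⁻¹' {b}).indicator (fun _ => (1 : ℝ)) |
      H ⊔ MeasurableSpace.comap z inferInstance]) ω = p (z ω) b)
    {h : E → A → ℝ} (hh : ∀ b, Measurable fun e => h e b) {c' : ℝ} (hhc : ∀ e b, |h e b| ≤ c') :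
    ∫ ω, Y ω * h (z ω) (a ω) ∂P = (∫ ω, Y ω ∂P) * ∫ e, ∑ b, p e b * h e b ∂D := by
  have hG : H ⊔ MeasurableSpace.comap z inferInstance ≤ mΩ := sup_le hH hz.comap_le
  have hY' : Measurable Y := hY.mono hH le_rfl
  have hbound : ∀ b ω, |Y ω * h (z ω) b| ≤ c * c' := fun b ω => by
    rw [abs_mul]
    exact mul_le_mul (hYc ω) (hhc _ _) (abs_nonneg _) ((abs_nonneg _).trans (hYc ω))
  have hindi : ∀ b, Integrable ((a ⁻¹' {b}).indicator (fun _ => (1 : ℝ))) P := fun b =>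
    (integrable_const _).indicator (ha (measurableSet_singleton b))
  have hmeas : ∀ b, Measurable[H ⊔ MeasurableSpace.comap z inferInstance]
      fun ω => Y ω * h (z ω) b := fun b => by
    refine Measurable.mul (hY.mono le_sup_left le_rfl) ?_
    exact (hh b).comp ((comap_measurable z).mono le_sup_right le_rfl)
  have hsplit : ∀ ω, Y ω * h (z ω) (a ω) =
      ∑ b, (Y ω * h (z ω) b) * (a ⁻¹' {b}).indicator (fun _ => (1 : ℝ)) ω := by
    intro ω
    classical simp [Set.indicator_apply]
  have hterm : ∀ b, ∫ ω, (Y ω * h (z ω) b) * (a ⁻¹' {b}).indicator (fun _ => (1 : ℝ)) ω ∂P =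
      (∫ ω, Y ω ∂P) * ∫ e, p e b * h e b ∂D := by
    intro b
    -- Conditioning on the past and on `z` replaces the indicator of action `b` by `p (z ω) b`;
    -- where `Y` vanishes nothing is needed. Independence of `z` from the past then factors the
    -- integral.
    have h1 := condExp_stronglyMeasurable_mul_of_bound hG (hmeas b).stronglyMeasurable (hindi b)
      (c * c') (Filter.Eventually.of_forall (hbound b))
    have h2 : ∫ ω, (Y ω * h (z ω) b) * (a ⁻¹' {b}).indicator (fun _ => (1 : ℝ)) ω ∂P =
        ∫ ω, Y ω * (p (z ω) b * h (z ω) b) ∂P := by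
      rw [← integral_condExp hG]
      refine integral_congr_ae ?_
      refine Filter.EventuallyEq.trans h1 ?_
      filter_upwards [hact b] with ω hω
      simp only [Pi.mul_apply]
      by_cases h0 : Y ω = 0
      · simp [h0]
      · rw [hω h0]; ring
    have hph : Measurable fun e => p e b * h e b := (hp.measurable b).mul (hh b)
    rw [h2, ← hlaw, integral_map hz.aemeasurable hph.aestronglyMeasurable]
    have hm : Measurable[MeasurableSpace.comap z inferInstance]
        fun ω => p (z ω) b * h (z ω) b :=
      ((hp.measurable b).mul (hh b)).comp (comap_measurable z)
    have hi : IndepFun Y (fun ω => p (z ω) b * h (z ω) b) P := by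
      rw [IndepFun_iff_Indep]
      exact indep_of_indep_of_le_left (indep_of_indep_of_le_right hind.symm hm.comap_le)
        hY.comap_le
    exact hi.integral_mul_eq_mul_integral hY'.aestronglyMeasurable
      (hm.mono hz.comap_le le_rfl).aestronglyMeasurable
  simp_rw [hsplit]
  rw [integral_finsetSum _ fun b _ => ?_, integral_finsetSum _ fun b _ => ?_, Finset.mul_sum]
  · exact Finset.sum_congr rfl fun b _ => hterm b
  · have : IsProbabilityMeasure D := hlaw ▸ Measure.isProbabilityMeasure_map hz.aemeasurable
    refine integrable_of_abs_le ((hp.measurable b).mul (hh b)) c' fun e => ?_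
    rw [abs_mul, abs_of_nonneg (hp.nonneg e b)]
    nlinarith [hp.le_one e b, hp.nonneg e b, hhc e b, abs_nonneg (h e b)]
  · refine (hindi b).bdd_mul ((hmeas b).mono hG le_rfl).aestronglyMeasurable
      (Filter.Eventually.of_forall (hbound b))

end Round

/-! ### Runs of the algorithm and exponential supermartingales. -/

section Run

variable {Ω X A : Type*} [MeasurableSpace Ω] [MeasurableSpace X] [Fintype A] [DecidableEq A]
  [MeasurableSpace A] [MeasurableSingletonClass A] {F : Finset (X → A → unitInterval)}

/-- The exploration policy of round `t` when the predictor `f` is in use. -/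
def roundPolicy (pol : F → X → A) (τ : ℕ → ℕ) (δ : ℝ) (t : ℕ) (f : F)
    (z : X × (A → unitInterval)) (b : A) : ℝ :=
  selectProb (learningRate (Fintype.card A) F.card δ τ (epochAt τ t))
    ((f : X → A → unitInterval) z.1) (pol f z.1) b

/-- The predictor in use in round `t`. -/
def predictorAt (oracle : (n : ℕ) → (Fin n → Datum X A) → F) (τ : ℕ → ℕ) (x : ℕ → Ω → X)
    (r : ℕ → Ω → A → unitInterval) (a : ℕ → Ω → A) (t : ℕ) (ω : Ω) : F :=
  (state oracle τ (observed x r a ω) t).predictor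

theorem actionProb_eq_roundPolicy (oracle : (n : ℕ) → (Fin n → Datum X A) → F) (pol : F → X → A)
    (τ : ℕ → ℕ) (δ : ℝ) (x : ℕ → Ω → X) (r : ℕ → Ω → A → unitInterval) (a : ℕ → Ω → A) (t : ℕ)
    (ω : Ω) (b : A) :
    actionProb oracle pol τ δ (observed x r a ω) t (x t ω) b =
      roundPolicy pol τ δ t (predictorAt oracle τ x r a t ω) (x t ω, r t ω) b := by
  simp only [actionProb, roundPolicy, predictorAt, state_epoch]

theorem learningRate_nonneg (K N : ℕ) (δ : ℝ) (τ : ℕ → ℕ) (m : ℕ) :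
    0 ≤ learningRate K N δ τ m := by
  unfold learningRate
  split_ifs <;> positivity

theorem IsGreedyPolicy.isGreedy {pol : F → X → A} (hpol : IsGreedyPolicy F pol)
    (hF : ∀ f ∈ F, ∀ b : A, Measurable fun x => f x b) (f : F) :
    IsGreedy (fun z : X × (A → unitInterval) => (f : X → A → unitInterval) z.1)
      (fun z => pol f z.1) where
  measurable_predictor b := (hF f f.2 b).comp measurable_fst
  measurable := (hpol.measurable f).comp measurable_fst
  isMax z b := hpol.isMax f z.1 b

theorem isStochasticPolicy_roundPolicy {pol : F → X → A} (hpol : IsGreedyPolicy F pol)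
    (hF : ∀ f ∈ F, ∀ b : A, Measurable fun x => f x b) (τ : ℕ → ℕ) (δ : ℝ) (t : ℕ) (f : F) :
    IsStochasticPolicy (roundPolicy pol τ δ t f) :=
  isStochasticPolicy_selectProb (hpol.isGreedy hF f) (learningRate_nonneg _ _ _ _ _)

section History

variable {x : ℕ → Ω → X} {r : ℕ → Ω → A → unitInterval} {a : ℕ → Ω → A}

theorem history_mono {s t : ℕ} (h : s ≤ t) : history x r a s ≤ history x r a t :=
  iSup_le fun i => le_iSup (fun j : Fin t =>
    MeasurableSpace.comap (fun ω => (x j ω, r j ω, a j ω)) inferInstance) (Fin.castLE h i)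

theorem measurable_history {s t : ℕ} (h : s < t) :
    Measurable[history x r a t] fun ω => (x s ω, r s ω, a s ω) :=
  (comap_measurable _).mono (le_iSup (fun j : Fin t =>
    MeasurableSpace.comap (fun ω => (x j ω, r j ω, a j ω)) inferInstance) ⟨s, h⟩) le_rfl

theorem measurable_observed {s t : ℕ} (h : s < t) :
    Measurable[history x r a t] fun ω => observed x r a ω s := by
  have h1 : Measurable fun y : X × (A → unitInterval) × A => (y.1, y.2.2, y.2.1 y.2.2) := by
    have h2 : Measurable fun y : (A → unitInterval) × A => y.1 y.2 :=
      measurable_from_prod_countable_left fun b => measurable_pi_apply b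
    have h3 : Measurable fun y : X × (A → unitInterval) × A => y.2.1 y.2.2 :=
      h2.comp measurable_snd
    fun_prop
  exact h1.comp (measurable_history h)

/-- The predictor depends only on the data before its epoch, all of which belong to the first `t`
rounds. -/
theorem measurableSet_predictorAt {oracle : (n : ℕ) → (Fin n → Datum X A) → F}
    (horacle : IsLeastSquaresOracle F oracle) {τ : ℕ → ℕ} (hτ : IsEpochSchedule τ) (t : ℕ) (f : F) :
    MeasurableSet[history x r a t] {ω | predictorAt oracle τ x r a t ω = f} := by
  have h1 : {ω | predictorAt oracle τ x r a t ω = f} =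
      (fun ω => fun i : Fin (epochStart τ t) => observed x r a ω i) ⁻¹'
        {d | oracle (epochStart τ t) d = f} := by
    ext ω
    simp [predictorAt, state_predictor _ _ hτ]
  have h2 : Measurable[history x r a t] fun ω => fun i : Fin (epochStart τ t) =>
      observed x r a ω i :=
    @measurable_pi_lambda _ _ _ (history x r a t) _ _ fun i =>
      measurable_observed (i.2.trans_le (epochStart_le_lt hτ t).1)
  rw [h1]
  exact h2 (horacle.measurable _ f)

end History

variable {oracle : (n : ℕ) → (Fin n → Datum X A) → F} {pol : F → X → A} {τ : ℕ → ℕ} {δ : ℝ}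
  {D : Measure (X × (A → unitInterval))} {P : Measure Ω} {x : ℕ → Ω → X}
  {r : ℕ → Ω → A → unitInterval} {a : ℕ → Ω → A}

theorem IsRun.history_le (hrun : IsRun oracle pol τ δ D P x r a) (t : ℕ) :
    history x r a t ≤ ‹MeasurableSpace Ω› :=
  iSup_le fun s => ((hrun.measurable_context s).prodMk
    ((hrun.measurable_reward s).prodMk (hrun.measurable_action s))).comap_le

/-- The sum over the first `n` rounds of a function of the predictor in use, of the context and the
rewards, and of the action. -/
def runSum (oracle : (n : ℕ) → (Fin n → Datum X A) → F) (τ : ℕ → ℕ) (x : ℕ → Ω → X)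
    (r : ℕ → Ω → A → unitInterval) (a : ℕ → Ω → A)
    (u : ℕ → F → X × (A → unitInterval) → A → ℝ) (n : ℕ) (ω : Ω) : ℝ :=
  ∑ s ∈ Finset.range n, u s (predictorAt oracle τ x r a s ω) (x s ω, r s ω) (a s ω)

theorem measurable_runSum (horacle : IsLeastSquaresOracle F oracle) (hτ : IsEpochSchedule τ)
    {u : ℕ → F → X × (A → unitInterval) → A → ℝ} (hu : ∀ t f b, Measurable fun z => u t f z b)
    (n : ℕ) : Measurable[history x r a n] (runSum oracle τ x r a u n) := by
  classical
  refine Finset.measurable_sum (m := history x r a n) _ fun s hs => ?_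
  have hs' := Finset.mem_range.1 hs
  have h1 : (fun ω => u s (predictorAt oracle τ x r a s ω) (x s ω, r s ω) (a s ω)) =
      fun ω => ∑ f : F, if predictorAt oracle τ x r a s ω = f
        then u s f (x s ω, r s ω) (a s ω) else 0 := by
    ext ω
    simp
  rw [h1]
  refine Finset.measurable_sum (m := history x r a n) _ fun f _ => ?_
  refine Measurable.ite (m := history x r a n)
    (history_mono hs'.le _ (measurableSet_predictorAt horacle hτ s f)) ?_ measurable_const
  have h2 : Measurable fun y : X × (A → unitInterval) × A => u s f (y.1, y.2.1) y.2.2 := by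
    have h3 : Measurable fun y : (X × (A → unitInterval)) × A => u s f y.1 y.2 :=
      measurable_from_prod_countable_left (hu s f)
    exact h3.comp (by fun_prop :
      Measurable fun y : X × (A → unitInterval) × A => ((y.1, y.2.1), y.2.2))
  exact h2.comp (measurable_history hs')

theorem abs_runSum_le {u : ℕ → F → X × (A → unitInterval) → A → ℝ} {c : ℝ}
    (hc : ∀ t f z b, |u t f z b| ≤ c) (n : ℕ) (ω : Ω) :
    |runSum oracle τ x r a u n ω| ≤ n * c := by
  refine (Finset.abs_sum_le_sum_abs _ _).trans ?_
  refine (Finset.sum_le_card_nsmul _ _ c fun s _ => hc _ _ _ _).trans ?_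
  simp

/-- The predictor in use is random but has finitely many values. On the event that it equals `f`,
the exploration policy is a fixed one and `integral_mul_round` applies. -/
theorem IsRun.integral_mul_indicator [IsProbabilityMeasure P]
    (hrun : IsRun oracle pol τ δ D P x r a)
    (horacle : IsLeastSquaresOracle F oracle) (hτ : IsEpochSchedule τ)
    (hpol : IsGreedyPolicy F pol) (hF : ∀ f ∈ F, ∀ b : A, Measurable fun x => f x b)
    (t : ℕ) (f : F) {Y : Ω → ℝ} (hY : Measurable[history x r a t] Y) {c : ℝ}
    (hYc : ∀ ω, |Y ω| ≤ c) {h : X × (A → unitInterval) → A → ℝ}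
    (hh : ∀ b, Measurable fun e => h e b) {c' : ℝ} (hhc : ∀ e b, |h e b| ≤ c') :
    ∫ ω, {ω | predictorAt oracle τ x r a t ω = f}.indicator Y ω * h (x t ω, r t ω) (a t ω) ∂P =
      (∫ ω, {ω | predictorAt oracle τ x r a t ω = f}.indicator Y ω ∂P) *
        ∫ z, ∑ b, roundPolicy pol τ δ t f z b * h z b ∂D := by
  refine integral_mul_round (hrun.history_le t)
    ((hrun.measurable_context t).prodMk (hrun.measurable_reward t)) (hrun.law t) (hrun.indep t)
    (hrun.measurable_action t) (isStochasticPolicy_roundPolicy hpol hF τ δ t f)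
    (hY.indicator (measurableSet_predictorAt horacle hτ t f)) (c := c) (fun ω => ?_) (fun b => ?_)
    hh hhc
  · by_cases hω : ω ∈ {ω | predictorAt oracle τ x r a t ω = f}
    · rw [Set.indicator_of_mem hω]; exact hYc ω
    · rw [Set.indicator_of_notMem hω, abs_zero]; exact (abs_nonneg _).trans (hYc ω)
  · filter_upwards [hrun.action t b] with ω hω hne
    rw [hω, actionProb_eq_roundPolicy]
    have : predictorAt oracle τ x r a t ω = f := by
      by_contra hf
      exact hne (Set.indicator_of_notMem (s := {ω | predictorAt oracle τ x r a t ω = f}) hf _)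
    rw [this]

/-- An exponential supermartingale bound along a run. -/
theorem IsRun.integral_exp_runSum_le_one [IsProbabilityMeasure P]
    (hrun : IsRun oracle pol τ δ D P x r a)
    (horacle : IsLeastSquaresOracle F oracle) (hτ : IsEpochSchedule τ)
    (hpol : IsGreedyPolicy F pol) (hF : ∀ f ∈ F, ∀ b : A, Measurable fun x => f x b)
    {u : ℕ → F → X × (A → unitInterval) → A → ℝ} (hu : ∀ t f b, Measurable fun z => u t f z b)
    {c : ℝ} (hc : ∀ t f z b, |u t f z b| ≤ c)
    (hexp : ∀ t f, ∫ z, ∑ b, roundPolicy pol τ δ t f z b * Real.exp (u t f z b) ∂D ≤ 1) (n : ℕ) :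
    ∫ ω, Real.exp (runSum oracle τ x r a u n ω) ∂P ≤ 1 := by
  induction n with
  | zero => simp [runSum]
  | succ n ih =>
    set M : Ω → ℝ := fun ω => Real.exp (runSum oracle τ x r a u n ω) with hM
    have hMm : Measurable[history x r a n] M :=
      Real.measurable_exp.comp (measurable_runSum horacle hτ hu n)
    have hMb : ∀ ω, |M ω| ≤ Real.exp (n * c) := fun ω => by
      rw [hM, Real.abs_exp, Real.exp_le_exp]
      exact (le_abs_self _).trans (abs_runSum_le hc n ω)
    let S : F → Set Ω := fun f => {ω | predictorAt oracle τ x r a n ω = f}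
    have hS : ∀ f, MeasurableSet (S f) := fun f =>
      hrun.history_le n _ (measurableSet_predictorAt horacle hτ n f)
    have hMm' := hMm.mono (hrun.history_le n) le_rfl
    have hMi : Integrable M P := integrable_of_abs_le hMm' _ hMb
    have hz := (hrun.measurable_context n).prodMk (hrun.measurable_reward n)
    have hue : ∀ f e b, |Real.exp (u n f e b)| ≤ Real.exp c := fun f e b => by
      rw [Real.abs_exp, Real.exp_le_exp]
      exact (le_abs_self _).trans (hc _ _ _ _)
    have h1 : ∀ ω, Real.exp (runSum oracle τ x r a u (n + 1) ω) =
        ∑ f : F, (S f).indicator M ω * Real.exp (u n f (x n ω, r n ω) (a n ω)) := by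
      intro ω
      rw [runSum, Finset.sum_range_succ, Real.exp_add]
      classical simp [Set.indicator_apply, S, hM, runSum]
    have h2 : ∀ ω, M ω = ∑ f : F, (S f).indicator M ω := by
      intro ω
      classical simp [Set.indicator_apply, S]
    simp_rw [h1]
    rw [integral_finsetSum _ fun f _ => ?_]
    · calc _ = ∑ f : F, (∫ ω, (S f).indicator M ω ∂P) *
            ∫ z, ∑ b, roundPolicy pol τ δ n f z b * Real.exp (u n f z b) ∂D :=
          Finset.sum_congr rfl fun f _ => hrun.integral_mul_indicator horacle hτ hpol hF n f hMm hMb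
            (fun b => (hu n f b).exp) (hue f)
        _ ≤ ∑ f : F, (∫ ω, (S f).indicator M ω ∂P) * 1 := by
          refine Finset.sum_le_sum fun f _ => mul_le_mul_of_nonneg_left (hexp n f) ?_
          exact integral_nonneg fun ω => Set.indicator_nonneg (fun ω _ => (Real.exp_pos _).le) ω
        _ = ∫ ω, M ω ∂P := by
          simp_rw [mul_one]
          rw [← integral_finsetSum _ fun f _ => hMi.indicator (hS f)]
          simp_rw [← h2]
        _ ≤ 1 := ih
    · refine (hMi.indicator (hS f)).mul_bdd (c := Real.exp c) ?_
        (Filter.Eventually.of_forall fun ω => hue f _ _)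
      have h3 : Measurable fun y : (X × (A → unitInterval)) × A => Real.exp (u n f y.1 y.2) :=
        measurable_from_prod_countable_left fun b => (hu n f b).exp
      exact (h3.comp (hz.prodMk (hrun.measurable_action n))).aestronglyMeasurable

/-- Markov's inequality for the exponential of the sum. -/
theorem IsRun.measureReal_runSum_gt_le [IsProbabilityMeasure P]
    (hrun : IsRun oracle pol τ δ D P x r a)
    (horacle : IsLeastSquaresOracle F oracle) (hτ : IsEpochSchedule τ)
    (hpol : IsGreedyPolicy F pol) (hF : ∀ f ∈ F, ∀ b : A, Measurable fun x => f x b)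
    {u : ℕ → F → X × (A → unitInterval) → A → ℝ} (hu : ∀ t f b, Measurable fun z => u t f z b)
    {c : ℝ} (hc : ∀ t f z b, |u t f z b| ≤ c)
    (hexp : ∀ t f, ∫ z, ∑ b, roundPolicy pol τ δ t f z b * Real.exp (u t f z b) ∂D ≤ 1) (n : ℕ)
    {ε : ℝ} (hε : 0 < ε) :
    P.real {ω | Real.log (1 / ε) < runSum oracle τ x r a u n ω} ≤ ε := by
  have h1 := hrun.integral_exp_runSum_le_one horacle hτ hpol hF hu hc hexp n
  have hm := (measurable_runSum (x := x) (r := r) (a := a) horacle hτ hu n).mono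
    (hrun.history_le n) le_rfl
  have hi : Integrable (fun ω => Real.exp (runSum oracle τ x r a u n ω)) P :=
    integrable_of_abs_le hm.exp (Real.exp (n * c)) fun ω => by
      rw [Real.abs_exp, Real.exp_le_exp]
      exact (le_abs_self _).trans (abs_runSum_le hc n ω)
  have h2 := mul_meas_ge_le_integral_of_nonneg
    (Filter.Eventually.of_forall fun ω => (Real.exp_pos _).le) hi (1 / ε)
  have h3 : P.real {ω | Real.log (1 / ε) < runSum oracle τ x r a u n ω} ≤
      P.real {ω | 1 / ε ≤ Real.exp (runSum oracle τ x r a u n ω)} := by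
    refine measureReal_mono fun ω hω => ?_
    have := Real.exp_lt_exp.2 hω
    rw [Real.exp_log (by positivity)] at this
    exact this.le
  have h4 := h2.trans h1
  rw [div_mul_eq_mul_div, one_mul, div_le_iff₀ hε, one_mul] at h4
  exact h3.trans h4

end Run

/-! ### Exponential moments of one round. -/

/-- For `|V| ≤ 1` one has `exp V ≤ 1 + V + V ^ 2`, so the mean of `exp V` is at most `1 - k ≤ exp
(-k)`. -/
theorem integral_sum_mul_exp_le_one {Z A : Type*} [MeasurableSpace Z] [Fintype A] [DecidableEq A]
    {ν : Measure Z}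
    [IsProbabilityMeasure ν] {q V : Z → A → ℝ} (hq : IsStochasticPolicy q)
    (hV : ∀ b, Measurable fun z => V z b) (hV1 : ∀ z b, |V z b| ≤ 1) {k : ℝ}
    (h : ∫ z, ∑ b, q z b * V z b ∂ν + ∫ z, ∑ b, q z b * V z b ^ 2 ∂ν ≤ -k) :
    ∫ z, ∑ b, q z b * Real.exp (V z b + k) ∂ν ≤ 1 := by
  have i1 := integrable_sum_mul (ν := ν) hq hV 1 hV1
  have i2 := integrable_sum_mul (ν := ν) hq (fun b => (hV b).pow_const 2) 1 fun z b => by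
    rw [abs_pow]; exact pow_le_one₀ (abs_nonneg _) (hV1 z b)
  have i3 := integrable_sum_mul (ν := ν) hq (fun b => (hV b).exp) (Real.exp 1) fun z b => by
    rw [Real.abs_exp, Real.exp_le_exp]; exact (le_abs_self _).trans (hV1 z b)
  have i4 : Integrable (fun z => 1 + ∑ b, q z b * V z b) ν := (integrable_const 1).add i1
  have h1 : ∫ z, ∑ b, q z b * Real.exp (V z b) ∂ν ≤ 1 - k := by
    calc _ ≤ ∫ z, (1 + ∑ b, q z b * V z b + ∑ b, q z b * V z b ^ 2) ∂ν := by
          refine integral_mono i3 (i4.add i2) fun z => ?_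
          have e : (1 : ℝ) = ∑ b, q z b * 1 := by simp [hq.sum_eq_one]
          dsimp only
          rw [e, ← Finset.sum_add_distrib, ← Finset.sum_add_distrib]
          refine Finset.sum_le_sum fun b _ => ?_
          have := (abs_le.1 (Real.abs_exp_sub_one_sub_id_le (hV1 z b))).2
          have := mul_le_mul_of_nonneg_left this (hq.nonneg z b)
          linarith
      _ = 1 + ∫ z, ∑ b, q z b * V z b ∂ν + ∫ z, ∑ b, q z b * V z b ^ 2 ∂ν := by
          rw [integral_add i4 i2, integral_add (integrable_const _) i1]
          simp
      _ ≤ _ := by linarith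
  have e : ∀ z, ∑ b, q z b * Real.exp (V z b + k) =
      Real.exp k * ∑ b, q z b * Real.exp (V z b) := fun z => by
    rw [Finset.mul_sum]
    exact Finset.sum_congr rfl fun b _ => by rw [Real.exp_add]; ring
  simp_rw [e]
  rw [integral_const_mul]
  have h2 : 1 - k ≤ Real.exp (-k) := by linarith [Real.add_one_le_exp (-k)]
  calc _ ≤ Real.exp k * Real.exp (-k) :=
        mul_le_mul_of_nonneg_left (h1.trans h2) (Real.exp_pos _).le
    _ = 1 := by rw [← Real.exp_add]; simp

section Environment

variable {X A : Type*} [MeasurableSpace X] [Fintype A] [DecidableEq A]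
  {D : Measure (X × (A → unitInterval))} [IsProbabilityMeasure D] {fs : X → A → unitInterval}

theorem measurable_reward_apply (b : A) :
    Measurable fun z : X × (A → unitInterval) => (z.2 b : ℝ) :=
  measurable_subtype_coe.comp ((measurable_pi_apply b).comp measurable_snd)

theorem Realizes.integral_mul_reward (hfs : Realizes D fs) {φ : X → ℝ} (hφ : Measurable φ) {c : ℝ}
    (hc : ∀ x, |φ x| ≤ c) (b : A) :
    ∫ z, φ z.1 * (z.2 b : ℝ) ∂D = ∫ z, φ z.1 * (fs z.1 b : ℝ) ∂D := by
  have hle : MeasurableSpace.comap (Prod.fst : X × (A → unitInterval) → X) inferInstance ≤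
      (inferInstance : MeasurableSpace (X × (A → unitInterval))) := measurable_fst.comap_le
  have hφ' : Measurable[MeasurableSpace.comap (Prod.fst : X × (A → unitInterval) → X)
      inferInstance] fun z : X × (A → unitInterval) => φ z.1 := hφ.comp (comap_measurable _)
  have hr : Integrable (fun z : X × (A → unitInterval) => (z.2 b : ℝ)) D :=
    integrable_of_abs_le (measurable_reward_apply b) 1 fun _ => abs_unitInterval_le _
  have h1 := condExp_stronglyMeasurable_mul_of_bound hle hφ'.stronglyMeasurable hr c
    (Filter.Eventually.of_forall fun z => hc z.1)
  rw [← integral_condExp hle]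
  refine integral_congr_ae (Filter.EventuallyEq.trans h1 ?_)
  filter_upwards [hfs b] with z hz
  simp only [Pi.mul_apply, hz]

theorem Realizes.integral_sum_mul_reward (hfs : Realizes D fs)
    (hfsm : ∀ b, Measurable fun x => fs x b) {φ : X → A → ℝ}
    (hφ : ∀ b, Measurable fun x => φ x b) {c : ℝ} (hc : ∀ x b, |φ x b| ≤ c) :
    ∫ z, ∑ b, φ z.1 b * (z.2 b : ℝ) ∂D = ∫ z, ∑ b, φ z.1 b * (fs z.1 b : ℝ) ∂D := by
  have hb : ∀ x b (y : unitInterval), |φ x b * (y : ℝ)| ≤ c := fun x b y => by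
    rw [abs_mul]
    nlinarith [hc x b, abs_unitInterval_le y, abs_nonneg (φ x b), abs_nonneg (y : ℝ)]
  rw [integral_finsetSum _ fun b _ => ?_, integral_finsetSum _ fun b _ => ?_]
  · exact Finset.sum_congr rfl fun b _ => hfs.integral_mul_reward (hφ b) (fun x => hc x b) b
  · exact integrable_of_abs_le (((hφ b).comp measurable_fst).mul
      (measurable_subtype_coe.comp ((hfsm b).comp measurable_fst))) c fun z => hb _ _ _
  · exact integrable_of_abs_le (((hφ b).comp measurable_fst).mul
      (measurable_reward_apply b)) c fun z => hb _ _ _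

theorem IsStochasticPolicy.comp_fst {q : X → A → ℝ} (hq : IsStochasticPolicy q) :
    IsStochasticPolicy fun z : X × (A → unitInterval) => q z.1 where
  measurable b := (hq.measurable b).comp measurable_fst
  nonneg z b := hq.nonneg z.1 b
  sum_eq_one z := hq.sum_eq_one z.1

/-- The excess square loss of the predictor `g` over the predictor `fs` on one observation. -/
def excessLoss (g fs : X → A → unitInterval) (z : X × (A → unitInterval)) (b : A) : ℝ :=
  ((g z.1 b : ℝ) - z.2 b) ^ 2 - ((fs z.1 b : ℝ) - z.2 b) ^ 2

theorem measurable_excessLoss {g : X → A → unitInterval} (hg : ∀ b, Measurable fun x => g x b)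
    (hfsm : ∀ b, Measurable fun x => fs x b) (b : A) :
    Measurable fun z => excessLoss g fs z b := by
  have h1 : Measurable fun z : X × (A → unitInterval) => (g z.1 b : ℝ) :=
    measurable_subtype_coe.comp ((hg b).comp measurable_fst)
  have h2 : Measurable fun z : X × (A → unitInterval) => (fs z.1 b : ℝ) :=
    measurable_subtype_coe.comp ((hfsm b).comp measurable_fst)
  have h3 := measurable_reward_apply (X := X) b
  exact ((h1.sub h3).pow_const 2).sub ((h2.sub h3).pow_const 2)

theorem abs_excessLoss_le (g fs : X → A → unitInterval) (z : X × (A → unitInterval)) (b : A) :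
    |excessLoss g fs z b| ≤ 2 * |(g z.1 b : ℝ) - fs z.1 b| := by
  have : excessLoss g fs z b =
      (((g z.1 b : ℝ) - z.2 b) + ((fs z.1 b : ℝ) - z.2 b)) * ((g z.1 b : ℝ) - fs z.1 b) := by
    unfold excessLoss; ring
  rw [this, abs_mul]
  refine mul_le_mul_of_nonneg_right ((abs_add_le _ _).trans ?_) (abs_nonneg _)
  linarith [abs_sub_unitInterval_le (g z.1 b) (z.2 b), abs_sub_unitInterval_le (fs z.1 b) (z.2 b)]

/-- The excess loss is `(g - fs) ^ 2 + 2 (g - fs) (fs - r)`. The cross term has mean zero because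
its factor `q (g - fs)` depends on the context only. -/
theorem Realizes.integral_excessLoss (hfs : Realizes D fs)
    (hfsm : ∀ b, Measurable fun x => fs x b) {g : X → A → unitInterval}
    (hg : ∀ b, Measurable fun x => g x b) {q : X → A → ℝ} (hq : IsStochasticPolicy q) :
    ∫ z, ∑ b, q z.1 b * excessLoss g fs z b ∂D =
      sqDist D (fun z => g z.1) (fun z => fs z.1) (fun z => q z.1) := by
  have hgr : ∀ b, Measurable fun x => (g x b : ℝ) := fun b => measurable_subtype_coe.comp (hg b)
  have hfr : ∀ b, Measurable fun x => (fs x b : ℝ) := fun b =>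
    measurable_subtype_coe.comp (hfsm b)
  have hφ : ∀ b, Measurable fun x => q x b * ((g x b : ℝ) - fs x b) := fun b =>
    (hq.measurable b).mul ((hgr b).sub (hfr b))
  have hφb : ∀ x b, |q x b * ((g x b : ℝ) - fs x b)| ≤ 1 := fun x b => by
    rw [abs_mul, abs_of_nonneg (hq.nonneg x b)]
    exact mul_le_one₀ (hq.le_one x b) (abs_nonneg _) (abs_sub_unitInterval_le _ _)
  have key := hfs.integral_sum_mul_reward hfsm hφ hφb
  have hq' := hq.comp_fst
  have i0 : Integrable (fun z : X × (A → unitInterval) =>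
      ∑ b, q z.1 b * ((g z.1 b : ℝ) - fs z.1 b) ^ 2) D :=
    integrable_sqDist hq' (fun b => (hg b).comp measurable_fst)
      (fun b => (hfsm b).comp measurable_fst)
  have i1 : Integrable (fun z : X × (A → unitInterval) =>
      ∑ b, q z.1 b * ((g z.1 b : ℝ) - fs z.1 b) * (z.2 b : ℝ)) D := by
    refine integrable_finsetSum _ fun b _ => integrable_of_abs_le
      (((hφ b).comp measurable_fst).mul (measurable_reward_apply b)) 1 fun z => ?_
    rw [abs_mul]
    exact mul_le_one₀ (hφb _ _) (abs_nonneg _) (abs_unitInterval_le _)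
  have i2 : Integrable (fun z : X × (A → unitInterval) =>
      ∑ b, q z.1 b * ((g z.1 b : ℝ) - fs z.1 b) * (fs z.1 b : ℝ)) D := by
    refine integrable_finsetSum _ fun b _ => integrable_of_abs_le
      (((hφ b).comp measurable_fst).mul ((hfr b).comp measurable_fst)) 1 fun z => ?_
    rw [abs_mul]
    exact mul_le_one₀ (hφb _ _) (abs_nonneg _) (abs_unitInterval_le _)
  have i3 : Integrable (fun z : X × (A → unitInterval) =>
      2 * ∑ b, q z.1 b * ((g z.1 b : ℝ) - fs z.1 b) * (fs z.1 b : ℝ) -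
        2 * ∑ b, q z.1 b * ((g z.1 b : ℝ) - fs z.1 b) * (z.2 b : ℝ)) D :=
    (i2.const_mul 2).sub (i1.const_mul 2)
  have e : ∀ z : X × (A → unitInterval), ∑ b, q z.1 b * excessLoss g fs z b =
      ∑ b, q z.1 b * ((g z.1 b : ℝ) - fs z.1 b) ^ 2 +
      (2 * ∑ b, q z.1 b * ((g z.1 b : ℝ) - fs z.1 b) * (fs z.1 b : ℝ) -
        2 * ∑ b, q z.1 b * ((g z.1 b : ℝ) - fs z.1 b) * (z.2 b : ℝ)) := by
    intro z
    rw [Finset.mul_sum, Finset.mul_sum, ← Finset.sum_sub_distrib, ← Finset.sum_add_distrib]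
    exact Finset.sum_congr rfl fun b _ => by unfold excessLoss; ring
  simp_rw [e]
  rw [integral_add i0 i3,
    integral_sub (i2.const_mul 2) (i1.const_mul 2), integral_const_mul, integral_const_mul, key,
    sub_self, add_zero, sqDist]

/-- With `d` the squared distance, `-excess / 8` has mean `-d / 8` and second moment at most `d /
16`, because `|excess| ≤ 2 |g - fs|`. The second moment uses half of the drift and `d / 16` remains.
That variance is controlled by the mean is what yields a logarithmic total error. -/
theorem Realizes.integral_exp_excessLoss_le_one (hfs : Realizes D fs)
    (hfsm : ∀ b, Measurable fun x => fs x b) {g : X → A → unitInterval}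
    (hg : ∀ b, Measurable fun x => g x b) {q : X → A → ℝ} (hq : IsStochasticPolicy q) :
    ∫ z, ∑ b, q z.1 b * Real.exp (-(excessLoss g fs z b / 8) +
      sqDist D (fun z => g z.1) (fun z => fs z.1) (fun z => q z.1) / 16) ∂D ≤ 1 := by
  have hm := measurable_excessLoss hg hfsm
  have hq' := hq.comp_fst
  have habs : ∀ z b, |-(excessLoss g fs z b / 8)| ≤ |(g z.1 b : ℝ) - fs z.1 b| / 4 := fun z b => by
    rw [abs_neg, abs_div, abs_of_pos (by norm_num : (0 : ℝ) < 8)]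
    linarith [abs_excessLoss_le g fs z b]
  have habs1 : ∀ z b, |-(excessLoss g fs z b / 8)| ≤ 1 := fun z b => by
    linarith [habs z b, abs_sub_unitInterval_le (g z.1 b) (fs z.1 b)]
  refine integral_sum_mul_exp_le_one (V := fun z b => -(excessLoss g fs z b / 8)) hq'
    (fun b => ((hm b).div_const 8).neg) habs1 ?_
  have h1 : ∫ z, ∑ b, q z.1 b * -(excessLoss g fs z b / 8) ∂D =
      -(sqDist D (fun z => g z.1) (fun z => fs z.1) (fun z => q z.1) / 8) := by
    rw [← hfs.integral_excessLoss hfsm hg hq, ← integral_div, ← integral_neg]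
    congr 1 with z
    rw [Finset.sum_div, ← Finset.sum_neg_distrib]
    exact Finset.sum_congr rfl fun b _ => by ring
  have h2 : ∫ z, ∑ b, q z.1 b * (-(excessLoss g fs z b / 8)) ^ 2 ∂D ≤
      sqDist D (fun z => g z.1) (fun z => fs z.1) (fun z => q z.1) / 16 := by
    rw [sqDist, ← integral_div]
    refine integral_mono (integrable_sum_mul hq' (fun b => ((hm b).div_const 8).neg.pow_const 2) 1
      fun z b => ?_) ((integrable_sqDist hq' (fun b => (hg b).comp measurable_fst)
        (fun b => (hfsm b).comp measurable_fst)).div_const 16) fun z => ?_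
    · rw [abs_pow]; exact pow_le_one₀ (abs_nonneg _) (habs1 z b)
    · dsimp only
      rw [Finset.sum_div]
      refine Finset.sum_le_sum fun b _ => ?_
      rw [mul_div_assoc]
      refine mul_le_mul_of_nonneg_left ?_ (hq.nonneg _ _)
      rw [← sq_abs, ← sq_abs ((g z.1 b : ℝ) - fs z.1 b)]
      nlinarith [habs z b, abs_nonneg (-(excessLoss g fs z b / 8))]
  rw [h1]
  linarith

variable [MeasurableSpace A] [MeasurableSingletonClass A] {π : X → A}

/-- The centred variable has mean zero and absolute value at most `2 l ≤ 1`, whence the compensator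
`4 l ^ 2`. -/
theorem Realizes.integral_exp_regret_le_one (hfs : Realizes D fs) (hgr : IsGreedy fs π)
    {q : X → A → ℝ} (hq : IsStochasticPolicy q) {l : ℝ} (hl0 : 0 ≤ l) (hl : l ≤ 1 / 2) :
    ∫ z, ∑ b, q z.1 b * Real.exp (l * ((z.2 (π z.1) : ℝ) - z.2 b -
      policyRegret D (fun z => fs z.1) (fun z => π z.1) (fun z => q z.1)) + -(4 * l ^ 2)) ∂D
      ≤ 1 := by
  have hgr' : IsGreedy (fun z : X × (A → unitInterval) => fs z.1) (fun z => π z.1) :=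
    ⟨fun b => (hgr.measurable_predictor b).comp measurable_fst,
      hgr.measurable.comp measurable_fst, fun z => hgr.isMax z.1⟩
  have hq' := hq.comp_fst
  have hpt := isStochasticPolicy_pointPolicy hgr.measurable
  have hR0 := policyRegret_nonneg (ν := D) hgr' hq'
  have hR1 := policyRegret_le_one (ν := D) hgr' hq'
  -- Realizability, applied to the context-dependent weights `pointPolicy π - q`, exchanges
  -- predicted for actual rewards.
  have hReq : policyRegret D (fun z => fs z.1) (fun z => π z.1) (fun z => q z.1) =
      ∫ z, ∑ b, q z.1 b * ((z.2 (π z.1) : ℝ) - z.2 b) ∂D := by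
    have hφ : ∀ b, Measurable fun x => pointPolicy π x b - q x b := fun b =>
      (hpt.measurable b).sub (hq.measurable b)
    have hφb : ∀ x b, |pointPolicy π x b - q x b| ≤ 1 := fun x b => by
      rw [abs_le]
      constructor <;> linarith [hpt.nonneg x b, hpt.le_one x b, hq.nonneg x b, hq.le_one x b]
    have key := hfs.integral_sum_mul_reward hgr.measurable_predictor hφ hφb
    have e : ∀ (x : X) (y : A → ℝ), ∑ b, (pointPolicy π x b - q x b) * y b =
        ∑ b, q x b * (y (π x) - y b) := by
      intro x y
      simp_rw [sub_mul, mul_sub]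
      rw [Finset.sum_sub_distrib, Finset.sum_sub_distrib, sum_pointPolicy_mul, ← Finset.sum_mul,
        hq.sum_eq_one, one_mul]
    rw [policyRegret_eq_integral hgr' hq']
    simp_rw [fun z : X × (A → unitInterval) => e z.1 (fun b => (z.2 b : ℝ)),
      fun z : X × (A → unitInterval) => e z.1 (fun b => (fs z.1 b : ℝ))] at key
    exact key.symm
  set R := policyRegret D (fun z => fs z.1) (fun z => π z.1) (fun z => q z.1)
  have hmπ : Measurable fun z : X × (A → unitInterval) => (z.2 (π z.1) : ℝ) :=
    measurable_eval (u := fun (z : X × (A → unitInterval)) b => (z.2 b : ℝ))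
      measurable_reward_apply (hgr.measurable.comp measurable_fst)
  have hm : ∀ b, Measurable fun z : X × (A → unitInterval) =>
      l * ((z.2 (π z.1) : ℝ) - z.2 b - R) := fun b =>
    ((hmπ.sub (measurable_reward_apply b)).sub_const _).const_mul _
  have habs : ∀ (z : X × (A → unitInterval)) b,
      |l * ((z.2 (π z.1) : ℝ) - z.2 b - R)| ≤ 2 * l := fun z b => by
    have h1 := abs_le.1 (abs_sub_unitInterval_le (z.2 (π z.1)) (z.2 b))
    have h2 : |(z.2 (π z.1) : ℝ) - z.2 b - R| ≤ 2 := by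
      rw [abs_le]; constructor <;> linarith [h1.1, h1.2]
    rw [abs_mul, abs_of_nonneg hl0]
    nlinarith
  refine integral_sum_mul_exp_le_one hq' hm (fun z b => (habs z b).trans (by linarith)) ?_
  have i1 : Integrable (fun z : X × (A → unitInterval) =>
      ∑ b, q z.1 b * ((z.2 (π z.1) : ℝ) - z.2 b)) D :=
    integrable_sum_mul hq' (fun b => hmπ.sub (measurable_reward_apply b)) 1
      fun z b => abs_sub_unitInterval_le _ _
  have h1 : ∫ z, ∑ b, q z.1 b * (l * ((z.2 (π z.1) : ℝ) - z.2 b - R)) ∂D = 0 := by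
    have e : ∀ z : X × (A → unitInterval),
        ∑ b, q z.1 b * (l * ((z.2 (π z.1) : ℝ) - z.2 b - R)) =
          l * (∑ b, q z.1 b * ((z.2 (π z.1) : ℝ) - z.2 b) - R) := fun z => by
      have : R = ∑ b, q z.1 b * R := by rw [← Finset.sum_mul, hq.sum_eq_one, one_mul]
      nth_rewrite 2 [this]
      rw [← Finset.sum_sub_distrib, Finset.mul_sum]
      exact Finset.sum_congr rfl fun b _ => by ring
    simp_rw [e]
    rw [integral_const_mul, integral_sub i1 (integrable_const _), ← hReq]
    simp
  have h2 : ∫ z, ∑ b, q z.1 b * (l * ((z.2 (π z.1) : ℝ) - z.2 b - R)) ^ 2 ∂D ≤ 4 * l ^ 2 := by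
    calc _ ≤ ∫ _, 4 * l ^ 2 ∂D := by
          refine integral_mono_of_nonneg (Filter.Eventually.of_forall fun z => ?_)
            (integrable_const _) (Filter.Eventually.of_forall fun z => ?_)
          · exact Finset.sum_nonneg fun b _ => mul_nonneg (hq.nonneg _ _) (sq_nonneg _)
          · refine (le_abs_self _).trans (abs_sum_mul_le hq' z fun b => ?_)
            rw [abs_pow]
            nlinarith [habs z b, abs_nonneg (l * ((z.2 (π z.1) : ℝ) - z.2 b - R))]
      _ = _ := by simp
  rw [h1]
  linarith

end Environment

/-! ### Numerical inequalities. -/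

section Numeric

/-- The cost of the union bound: `2 N n (n + 1) / δ ≤ (N n / δ) ^ 3`. This fails for `N = n = 1` and
`δ` near `1`. -/
theorem log_union_le {N n : ℕ} (hN : 2 ≤ N) (hn : 1 ≤ n) {δ : ℝ} (hδ0 : 0 < δ) (hδ1 : δ < 1) :
    Real.log (1 / (δ / (2 * N * n * (n + 1)))) ≤ 3 * Real.log (N * n / δ) := by
  have hN' : (2 : ℝ) ≤ N := by exact_mod_cast hN
  have hn' : (1 : ℝ) ≤ n := by exact_mod_cast hn
  rw [one_div_div, ← Nat.cast_ofNat (R := ℝ) (n := 3), ← Real.log_pow]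
  refine Real.log_le_log (by positivity) ?_
  rw [div_pow, div_le_div_iff₀ hδ0 (by positivity)]
  have h1 : 2 * (N : ℝ) * n * (n + 1) ≤ (N * n) ^ 3 := by
    have h2 : 2 * (N : ℝ) * n * (n + 1) ≤ 4 * N * n ^ 2 := by
      have : (N : ℝ) * n ≤ N * n ^ 2 := by
        apply mul_le_mul_of_nonneg_left _ (by positivity)
        nlinarith
      nlinarith
    have h3 : (4 : ℝ) * N ≤ N ^ 3 := by nlinarith [mul_le_mul hN' hN' (by norm_num) (by positivity)]
    calc _ ≤ 4 * (N : ℝ) * n ^ 2 := h2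
      _ ≤ N ^ 3 * n ^ 2 := by gcongr
      _ ≤ N ^ 3 * n ^ 3 := by
        apply mul_le_mul_of_nonneg_left _ (by positivity)
        exact pow_le_pow_right₀ hn' (by norm_num)
      _ = _ := by ring
  have h4 : δ ^ 3 ≤ δ := by
    calc δ ^ 3 ≤ δ ^ 1 := pow_le_pow_of_le_one hδ0.le hδ1.le (by norm_num)
      _ = δ := pow_one δ
  calc _ ≤ (N * n : ℝ) ^ 3 * δ ^ 3 := by gcongr
    _ ≤ _ := by gcongr

/-- That is, `log (c n) / n` is nonincreasing; the step from `1` to `2` is exactly where `c ≥ 2` is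
needed. It serves to show that learning rates increase. -/
theorem mul_log_mono {c : ℝ} (hc : 2 ≤ c) {m n : ℕ} (hm : 1 ≤ m) (hmn : m ≤ n) :
    m * Real.log (c * n) ≤ n * Real.log (c * m) := by
  induction n, hmn using Nat.le_induction with
  | base => exact le_rfl
  | succ n hmn ih =>
    have hm' : (1 : ℝ) ≤ m := by exact_mod_cast hm
    have hn' : (1 : ℝ) ≤ n := by exact_mod_cast hm.trans hmn
    have step : n * Real.log (c * (n + 1)) ≤ (n + 1) * Real.log (c * n) := by
      have e : Real.log (c * (n + 1)) = Real.log (c * n) + Real.log ((n + 1) / n) := by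
        rw [← Real.log_mul (by positivity) (by positivity)]
        congr 1; field_simp
      have h1 : n * Real.log ((n + 1) / n) ≤ Real.log (c * n) := by
        rcases (hm.trans hmn).eq_or_lt with h | h
        · rw [← h]
          norm_num
          exact Real.log_le_log (by norm_num) hc
        · have h2 : Real.log ((n + 1) / n) ≤ 1 / n := by
            have := Real.log_le_sub_one_of_pos (show (0 : ℝ) < (n + 1) / n by positivity)
            have e : ((n : ℝ) + 1) / n - 1 = 1 / n := by field_simp; ring
            linarith
          have h3 : (n : ℝ) * Real.log ((n + 1) / n) ≤ 1 := by
            calc _ ≤ (n : ℝ) * (1 / n) := by gcongr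
              _ = 1 := by field_simp
          have h4 : (2 : ℝ) ≤ n := by exact_mod_cast h
          have h5 : Real.log 4 ≤ Real.log (c * n) := Real.log_le_log (by norm_num) (by nlinarith)
          have h6 : Real.log 4 = 2 * Real.log 2 := by
            rw [show (4 : ℝ) = 2 ^ 2 by norm_num, Real.log_pow]; norm_num
          linarith [Real.log_two_gt_d9]
      rw [e]; linarith
    push_cast
    have hn0 : (0 : ℝ) < n := by linarith
    refine le_of_mul_le_mul_left ?_ hn0
    calc (n : ℝ) * (m * Real.log (c * (n + 1))) = m * (n * Real.log (c * (n + 1))) := by ring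
      _ ≤ m * ((n + 1) * Real.log (c * n)) := by gcongr
      _ = (n + 1) * (m * Real.log (c * n)) := by ring
      _ ≤ (n + 1) * (n * Real.log (c * m)) := by gcongr
      _ = _ := by ring

theorem sum_one_div_sqrt_le (T : ℕ) : ∑ i ∈ Finset.range T, 1 / √((i : ℝ) + 1) ≤ 2 * √T := by
  induction T with
  | zero => simp
  | succ T ih =>
    rw [Finset.sum_range_succ]
    push_cast
    have h0 : 0 < √((T : ℝ) + 1) := Real.sqrt_pos.2 (by positivity)
    have h1 : √(T : ℝ) ^ 2 = T := Real.sq_sqrt (by positivity)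
    have h2 : √((T : ℝ) + 1) ^ 2 = T + 1 := Real.sq_sqrt (by positivity)
    have h3 : 1 / √((T : ℝ) + 1) ≤ 2 * √((T : ℝ) + 1) - 2 * √T := by
      rw [div_le_iff₀ h0]
      nlinarith [sq_nonneg (√((T : ℝ) + 1) - √T)]
    linarith

theorem sum_one_div_mul_le (T : ℕ) :
    ∑ i ∈ Finset.range T, 1 / (((i + 1 : ℕ) : ℝ) * ((i + 1 : ℕ) + 1)) ≤ 1 := by
  have : ∑ i ∈ Finset.range T, 1 / (((i + 1 : ℕ) : ℝ) * ((i + 1 : ℕ) + 1)) =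
      1 - 1 / ((T : ℝ) + 1) := by
    induction T with
    | zero => simp
    | succ T ih =>
      rw [Finset.sum_range_succ, ih]
      push_cast
      field_simp; ring
  rw [this]
  have : 0 ≤ 1 / ((T : ℝ) + 1) := by positivity
  linarith

end Numeric

/-! ### The learning rate. -/

section LearningRate

variable {K N : ℕ} {δ : ℝ} {τ : ℕ → ℕ}

theorem one_lt_mul_div {N n : ℕ} (hN : 1 ≤ N) (hn : 1 ≤ n) (hδ0 : 0 < δ) (hδ1 : δ < 1) :
    1 < (N : ℝ) * n / δ := by
  have hN' : (1 : ℝ) ≤ N := by exact_mod_cast hN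
  have hn' : (1 : ℝ) ≤ n := by exact_mod_cast hn
  rw [lt_div_iff₀ hδ0]
  nlinarith

theorem learningRate_epochAt_of_start_eq_zero (hτ : IsEpochSchedule τ) {t : ℕ}
    (h : epochStart τ t = 0) : learningRate K N δ τ (epochAt τ t) = 1 := by
  rw [learningRate, if_pos ((epochStart_eq_zero_iff hτ t).1 h)]

theorem learningRate_epochAt (hτ : IsEpochSchedule τ) {t : ℕ} (h : epochStart τ t ≠ 0) :
    learningRate K N δ τ (epochAt τ t) =
      1 / 30 * √((K * epochStart τ t) / Real.log (N * epochStart τ t / δ)) := by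
  rw [learningRate, if_neg (fun h' => h ((epochStart_eq_zero_iff hτ t).2 h')), epochStart]

theorem learningRate_epochAt_pos (hτ : IsEpochSchedule τ) (hK : 1 ≤ K) (hN : 1 ≤ N) (hδ0 : 0 < δ)
    (hδ1 : δ < 1) (t : ℕ) : 0 < learningRate K N δ τ (epochAt τ t) := by
  by_cases h : epochStart τ t = 0
  · rw [learningRate_epochAt_of_start_eq_zero hτ h]; norm_num
  · rw [learningRate_epochAt hτ h]
    have hn : 1 ≤ epochStart τ t := Nat.one_le_iff_ne_zero.2 h
    have := Real.log_pos (one_lt_mul_div hN hn hδ0 hδ1)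
    have : (0 : ℝ) < epochStart τ t := by exact_mod_cast hn
    have : (0 : ℝ) < K := by exact_mod_cast hK
    positivity

/-- `mul_log_mono` with `c = N / δ`. The first epoch is excluded because its rate `1` does not
follow the formula. -/
theorem learningRate_epochAt_mono (hτ : IsEpochSchedule τ) (hN : 2 ≤ N)
    (hδ0 : 0 < δ) (hδ1 : δ < 1) {s t : ℕ} (hst : s ≤ t) (hs : epochStart τ s ≠ 0) :
    learningRate K N δ τ (epochAt τ s) ≤ learningRate K N δ τ (epochAt τ t) := by
  have hle := epochStart_mono hτ hst
  have hs1 : 1 ≤ epochStart τ s := Nat.one_le_iff_ne_zero.2 hs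
  have ht : epochStart τ t ≠ 0 := by omega
  rw [learningRate_epochAt hτ hs, learningRate_epochAt hτ ht]
  have l1 := Real.log_pos (one_lt_mul_div (by omega : 1 ≤ N) hs1 hδ0 hδ1)
  have l2 := Real.log_pos (one_lt_mul_div (by omega : 1 ≤ N) (hs1.trans hle) hδ0 hδ1)
  refine mul_le_mul_of_nonneg_left (Real.sqrt_le_sqrt ?_) (by norm_num)
  rw [div_le_div_iff₀ l1 l2]
  have hc : (2 : ℝ) ≤ N / δ := by
    have : (2 : ℝ) ≤ N := by exact_mod_cast hN
    rw [le_div_iff₀ hδ0]; nlinarith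
  have := mul_log_mono hc hs1 hle
  rw [div_mul_eq_mul_div, div_mul_eq_mul_div] at this
  have hK0 : (0 : ℝ) ≤ K := by positivity
  nlinarith [mul_le_mul_of_nonneg_left this hK0]

theorem learningRate_epochAt_sq (hτ : IsEpochSchedule τ) (hN : 1 ≤ N) (hδ0 : 0 < δ) (hδ1 : δ < 1)
    {t : ℕ} (h : epochStart τ t ≠ 0) :
    learningRate K N δ τ (epochAt τ t) ^ 2 =
      K * epochStart τ t / (900 * Real.log (N * epochStart τ t / δ)) := by
  have hn : 1 ≤ epochStart τ t := Nat.one_le_iff_ne_zero.2 h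
  have := Real.log_pos (one_lt_mul_div hN hn hδ0 hδ1)
  rw [learningRate_epochAt hτ h, mul_pow, Real.sq_sqrt (by positivity)]
  generalize Real.log (N * epochStart τ t / δ) = l at this
  field_simp
  ring

/-- The exploration cost of a round after the first epoch. -/
theorem card_div_learningRate_le (hτ : IsEpochSchedule τ)
    (hdouble : ∀ m, 1 < m → τ m ≤ 2 * τ (m - 1)) (hK : 1 ≤ K) (hN : 1 ≤ N) (hδ0 : 0 < δ)
    (hδ1 : δ < 1) {t T : ℕ} (htT : t < T)
    (h : epochStart τ t ≠ 0) :
    K / learningRate K N δ τ (epochAt τ t) ≤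
      30 * √(2 * (K * Real.log (N * T / δ))) * (1 / √((t : ℝ) + 1)) := by
  have hn : 1 ≤ epochStart τ t := Nat.one_le_iff_ne_zero.2 h
  have hlt := epochStart_le_lt hτ t
  have he : epochAt τ t ≠ 1 := fun h' => h ((epochStart_eq_zero_iff hτ t).2 h')
  have he1 := one_le_epochAt (τ := τ) t
  -- The doubling condition: at least half of the first `t + 1` rounds precede the epoch, so its
  -- start may be traded for `t + 1` at the cost of a factor 2.
  have h2 : t + 1 ≤ 2 * epochStart τ t :=
    (Nat.succ_le_of_lt hlt.2).trans (hdouble _ (by omega))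
  have hg := learningRate_epochAt_pos (δ := δ) hτ hK hN hδ0 hδ1 t
  have hsq := learningRate_epochAt_sq (K := K) hτ hN hδ0 hδ1 h
  set g := learningRate K N δ τ (epochAt τ t)
  set n := epochStart τ t
  have l1 := Real.log_pos (one_lt_mul_div hN hn hδ0 hδ1)
  have hn' : (0 : ℝ) < n := by exact_mod_cast hn
  have hK' : (0 : ℝ) < K := by exact_mod_cast hK
  have hN' : (0 : ℝ) < N := by exact_mod_cast hN
  have hlog : Real.log (N * n / δ) ≤ Real.log (N * T / δ) := by
    apply Real.log_le_log (by positivity)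
    have : (n : ℝ) ≤ T := by exact_mod_cast (hlt.1.trans htT.le)
    gcongr
  have h2' : (t : ℝ) + 1 ≤ 2 * n := by exact_mod_cast h2
  have hrhs : 0 ≤ 30 * √(2 * (K * Real.log (N * T / δ))) * (1 / √((t : ℝ) + 1)) := by positivity
  refine (abs_le_of_sq_le_sq' ?_ hrhs).2
  have l2 : 0 < Real.log (N * T / δ) := l1.trans_le hlog
  rw [div_pow, hsq, mul_pow, mul_pow, div_pow, Real.sq_sqrt (by positivity),
    Real.sq_sqrt (by positivity)]
  have e1 : (K : ℝ) ^ 2 / (K * n / (900 * Real.log (N * n / δ))) =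
      900 * K * Real.log (N * n / δ) / n := by
    field_simp
  rw [e1, one_pow, mul_one_div, div_le_div_iff₀ hn' (by positivity)]
  have : Real.log (N * n / δ) * (t + 1) ≤ Real.log (N * T / δ) * (2 * n) := by gcongr
  nlinarith [mul_le_mul_of_nonneg_left this hK'.le]

end LearningRate

/-! ### The regret bound. -/

theorem sqDist_nonneg {Z A : Type*} [MeasurableSpace Z] [Fintype A] {ν : Measure Z}
    {q : Z → A → ℝ} (hq : IsStochasticPolicy q) (v w : Z → A → unitInterval) :
    0 ≤ sqDist ν v w q :=
  integral_nonneg fun z => Finset.sum_nonneg fun b _ => mul_nonneg (hq.nonneg z b) (sq_nonneg _)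

theorem sqDist_le_one {Z A : Type*} [MeasurableSpace Z] [Fintype A] [DecidableEq A] {ν : Measure Z}
    [IsProbabilityMeasure ν] {q : Z → A → ℝ} (hq : IsStochasticPolicy q)
    (v w : Z → A → unitInterval) : sqDist ν v w q ≤ 1 := by
  calc _ ≤ ∫ _, (1 : ℝ) ∂ν := by
        refine integral_mono_of_nonneg (Filter.Eventually.of_forall fun z => ?_)
          (integrable_const _) (Filter.Eventually.of_forall fun z => ?_)
        · exact Finset.sum_nonneg fun b _ => mul_nonneg (hq.nonneg z b) (sq_nonneg _)
        · refine (le_abs_self _).trans (abs_sum_mul_le hq z fun b => ?_)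
          rw [abs_pow]
          exact pow_le_one₀ (abs_nonneg _) (abs_sub_unitInterval_le _ _)
    _ = 1 := by simp

theorem abs_regret_le {Ω X A : Type*} (π : X → A) (x : ℕ → Ω → X)
    (r : ℕ → Ω → A → unitInterval) (a : ℕ → Ω → A) (T : ℕ) (ω : Ω) :
    |regret π x r a T ω| ≤ T := by
  refine (Finset.abs_sum_le_sum_abs _ _).trans ?_
  refine (Finset.sum_le_card_nsmul _ _ 1 fun s _ => abs_sub_unitInterval_le _ _).trans ?_
  simp

section Main

variable {Ω X A : Type*} [MeasurableSpace Ω] [MeasurableSpace X] [Fintype A] [DecidableEq A]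
  [MeasurableSpace A] [MeasurableSingletonClass A] {F : Finset (X → A → unitInterval)}
  {oracle : (n : ℕ) → (Fin n → Datum X A) → F} {pol : F → X → A} {τ : ℕ → ℕ} {δ : ℝ}
  {D : Measure (X × (A → unitInterval))} [IsProbabilityMeasure D] {P : Measure Ω}
  [IsProbabilityMeasure P] {x : ℕ → Ω → X} {r : ℕ → Ω → A → unitInterval} {a : ℕ → Ω → A}
  {fStar : F}

/-- The expected regret, in round `t`, of the exploration policy for the predictor `f`. -/
def roundRegret (D : Measure (X × (A → unitInterval))) (fStar : F) (pol : F → X → A) (τ : ℕ → ℕ)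
    (δ : ℝ) (t : ℕ) (f : F) : ℝ :=
  policyRegret D (fun z => (fStar : X → A → unitInterval) z.1) (fun z => pol fStar z.1)
    (roundPolicy pol τ δ t f)

/-- The expected squared error of `g`, in round `t`, under the exploration policy for `f`. -/
def roundError (D : Measure (X × (A → unitInterval))) (fStar : F) (pol : F → X → A) (τ : ℕ → ℕ)
    (δ : ℝ) (g : F) (t : ℕ) (f : F) : ℝ :=
  sqDist D (fun z => (g : X → A → unitInterval) z.1)
    (fun z => (fStar : X → A → unitInterval) z.1) (roundPolicy pol τ δ t f)

/-- The increment of the log-supermartingale that controls the squared error of `g`. -/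
def errorIncrement (D : Measure (X × (A → unitInterval))) (fStar : F) (pol : F → X → A)
    (τ : ℕ → ℕ) (δ : ℝ) (g : F) (t : ℕ) (f : F) (z : X × (A → unitInterval)) (b : A) : ℝ :=
  -(excessLoss (g : X → A → unitInterval) (fStar : X → A → unitInterval) z b / 8) +
    roundError D fStar pol τ δ g t f / 16

/-- The increment of the log-supermartingale that controls the realized regret. -/
def regretIncrement (D : Measure (X × (A → unitInterval))) (fStar : F) (pol : F → X → A)
    (τ : ℕ → ℕ) (δ l : ℝ) (t : ℕ) (f : F) (z : X × (A → unitInterval)) (b : A) : ℝ :=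
  l * ((z.2 (pol fStar z.1) : ℝ) - z.2 b - roundRegret D fStar pol τ δ t f) + -(4 * l ^ 2)

theorem isStochasticPolicy_selectProb_context (hpol : IsGreedyPolicy F pol)
    (hF : ∀ f ∈ F, ∀ b : A, Measurable fun x => f x b) (t : ℕ) (f : F) :
    IsStochasticPolicy fun x => selectProb (learningRate (Fintype.card A) F.card δ τ (epochAt τ t))
      ((f : X → A → unitInterval) x) (pol f x) :=
  isStochasticPolicy_selectProb ⟨hF f f.2, hpol.measurable f, hpol.isMax f⟩
    (learningRate_nonneg _ _ _ _ _)

theorem IsRun.measureReal_errorIncrement_le (hrun : IsRun oracle pol τ δ D P x r a)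
    (horacle : IsLeastSquaresOracle F oracle) (hτ : IsEpochSchedule τ)
    (hpol : IsGreedyPolicy F pol) (hF : ∀ f ∈ F, ∀ b : A, Measurable fun x => f x b)
    (hfs : Realizes D (fStar : X → A → unitInterval)) (g : F) (n : ℕ) {ε : ℝ} (hε : 0 < ε) :
    P.real {ω | Real.log (1 / ε) <
      runSum oracle τ x r a (errorIncrement D fStar pol τ δ g) n ω} ≤ ε := by
  refine hrun.measureReal_runSum_gt_le horacle hτ hpol hF (fun t f b => ?_) (c := 1)
    (fun t f z b => ?_) (fun t f => ?_) n hε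
  · exact ((measurable_excessLoss (hF g g.2) (hF fStar fStar.2) b).div_const 8).neg.add_const _
  · have hq := isStochasticPolicy_roundPolicy hpol hF τ δ t f
    have h1 := sqDist_nonneg (ν := D) hq (fun z => (g : X → A → unitInterval) z.1)
      (fun z => (fStar : X → A → unitInterval) z.1)
    have h2 := sqDist_le_one (ν := D) hq (fun z => (g : X → A → unitInterval) z.1)
      (fun z => (fStar : X → A → unitInterval) z.1)
    have h3 := abs_excessLoss_le (g : X → A → unitInterval) (fStar : X → A → unitInterval) z b
    have h4 := abs_sub_unitInterval_le ((g : X → A → unitInterval) z.1 b)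
      ((fStar : X → A → unitInterval) z.1 b)
    have h5 := abs_le.1 (h3.trans (by linarith :
      2 * |((g : X → A → unitInterval) z.1 b : ℝ) - (fStar : X → A → unitInterval) z.1 b| ≤ 2))
    unfold errorIncrement roundError
    rw [abs_le]
    constructor <;> linarith [h5.1, h5.2]
  · exact hfs.integral_exp_excessLoss_le_one (hF fStar fStar.2) (hF g g.2)
      (isStochasticPolicy_selectProb_context hpol hF t f)

theorem IsRun.measureReal_regretIncrement_le (hrun : IsRun oracle pol τ δ D P x r a)
    (horacle : IsLeastSquaresOracle F oracle) (hτ : IsEpochSchedule τ)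
    (hpol : IsGreedyPolicy F pol) (hF : ∀ f ∈ F, ∀ b : A, Measurable fun x => f x b)
    (hfs : Realizes D (fStar : X → A → unitInterval)) {l : ℝ} (hl0 : 0 ≤ l) (hl : l ≤ 1 / 2)
    (n : ℕ) {ε : ℝ} (hε : 0 < ε) :
    P.real {ω | Real.log (1 / ε) <
      runSum oracle τ x r a (regretIncrement D fStar pol τ δ l) n ω} ≤ ε := by
  have hgr : IsGreedy (fStar : X → A → unitInterval) (pol fStar) :=
    ⟨hF fStar fStar.2, hpol.measurable fStar, hpol.isMax fStar⟩
  refine hrun.measureReal_runSum_gt_le horacle hτ hpol hF (fun t f b => ?_) (c := 2)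
    (fun t f z b => ?_) (fun t f => ?_) n hε
  · have hmπ : Measurable fun z : X × (A → unitInterval) => (z.2 (pol fStar z.1) : ℝ) :=
      measurable_eval (u := fun (z : X × (A → unitInterval)) b => (z.2 b : ℝ))
        measurable_reward_apply (hgr.measurable.comp measurable_fst)
    exact (((hmπ.sub (measurable_reward_apply b)).sub_const _).const_mul _).add_const _
  · have hq := isStochasticPolicy_roundPolicy hpol hF τ δ t f
    have h1 := policyRegret_nonneg (ν := D) (hpol.isGreedy hF fStar) hq
    have h2 := policyRegret_le_one (ν := D) (hpol.isGreedy hF fStar) hq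
    have h3 := abs_le.1 (abs_sub_unitInterval_le (z.2 (pol fStar z.1)) (z.2 b))
    unfold regretIncrement roundRegret
    rw [abs_le]
    constructor <;> nlinarith [h3.1, h3.2]
  · exact hfs.integral_exp_regret_le_one hgr
      (isStochasticPolicy_selectProb_context hpol hF t f) hl0 hl

/-- Through this identity, optimality of the oracle makes the observed excess loss of its output
nonpositive. -/
theorem sum_excessLoss_eq (g f : X → A → unitInterval) (n : ℕ) (ω : Ω) :
    ∑ s ∈ Finset.range n, excessLoss g f (x s ω, r s ω) (a s ω) =
      squareLoss g (fun i : Fin n => observed x r a ω i) -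
        squareLoss f (fun i : Fin n => observed x r a ω i) := by
  rw [squareLoss, squareLoss, ← Finset.sum_sub_distrib]
  exact (Fin.sum_univ_eq_sum_range
    (fun s => excessLoss g f (x s ω, r s ω) (a s ω)) n).symm

/-- If the squared errors are controlled, then every round has small expected regret. -/
theorem roundRegret_le (horacle : IsLeastSquaresOracle F oracle) (hτ : IsEpochSchedule τ)
    (hpol : IsGreedyPolicy F pol) (hF : ∀ f ∈ F, ∀ b : A, Measurable fun x => f x b)
    (hδ0 : 0 < δ) (hδ1 : δ < 1) {T : ℕ} {ω : Ω}
    (hgood : ∀ i < T, ∀ g : F, runSum oracle τ x r a (errorIncrement D fStar pol τ δ g) (i + 1) ω ≤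
      Real.log (1 / (δ / (2 * F.card * (i + 1 : ℕ) * ((i + 1 : ℕ) + 1))))) {t : ℕ} (ht : t < T) :
    roundRegret D fStar pol τ δ t (predictorAt oracle τ x r a t ω) ≤
      3 * (Fintype.card A / learningRate (Fintype.card A) F.card δ τ (epochAt τ t)) := by
  have hN : 1 ≤ F.card := Finset.card_pos.2 ⟨fStar, fStar.2⟩
  have hX : Nonempty X := ⟨x 0 ω⟩
  have hK : 1 ≤ Fintype.card A := Fintype.card_pos_iff.2 ⟨a 0 ω⟩
  have hrate := learningRate_epochAt_pos (K := Fintype.card A) hτ hK hN hδ0 hδ1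
  have hown := fun t => policyRegret_selectProb_le (ν := D)
    (hpol.isGreedy hF (predictorAt oracle τ x r a t ω)) (hrate t)
  have hKr : 0 ≤ (Fintype.card A : ℝ) /
      learningRate (Fintype.card A) F.card δ τ (epochAt τ t) :=
    div_nonneg (Nat.cast_nonneg _) (hrate t).le
  -- A single predictor is `fStar`, so estimated and true regret coincide. `log_union_le` and the
  -- monotonicity of the rates require two predictors.
  rcases hN.eq_or_lt with h1 | h2
  · have : predictorAt oracle τ x r a t ω = fStar :=
      Subtype.ext (Finset.card_le_one.1 h1.symm.le _ (Subtype.property _) _ fStar.2)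
    have h := hown t
    rw [this] at h ⊢
    refine le_trans h ?_
    linarith
  have main := policyRegret_le_and_le (ν := D) (T := T) (start := epochStart τ)
    (v := fun t z => (predictorAt oracle τ x r a t ω : X → A → unitInterval) z.1)
    (p := fun t z => pol (predictorAt oracle τ x r a t ω) z.1)
    (γ := fun t => learningRate (Fintype.card A) F.card δ τ (epochAt τ t))
    (fun t => hpol.isGreedy hF _) (hpol.isGreedy hF fStar) hrate
    (fun t => (epochStart_le_lt hτ t).1)
    (fun t => learningRate_epochAt_of_start_eq_zero hτ)
    (fun s t hst hs => learningRate_epochAt_mono hτ h2 hδ0 hδ1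
      (hst.le.trans (epochStart_le_lt hτ t).1) hs)
    ?_ t ht _ (isStochasticPolicy_roundPolicy hpol hF τ δ t (predictorAt oracle τ x r a t ω))
  · have h := hown t
    unfold roundRegret
    refine le_trans main.1 ?_
    have h' : policyRegret D
        (fun z => (predictorAt oracle τ x r a t ω : X → A → unitInterval) z.1)
        (fun z => pol (predictorAt oracle τ x r a t ω) z.1)
        (roundPolicy pol τ δ t (predictorAt oracle τ x r a t ω)) ≤ _ := h
    linarith
  · intro t ht hn
    obtain ⟨i, hi⟩ : ∃ i, epochStart τ t = i + 1 := ⟨epochStart τ t - 1, by omega⟩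
    have hit : i < T := by have := (epochStart_le_lt hτ t).1; omega
    have hg := hgood i hit (predictorAt oracle τ x r a t ω)
    have hlog := log_union_le (n := i + 1) h2 (by omega) hδ0 hδ1
    rw [learningRate_epochAt_sq hτ hN hδ0 hδ1 hn.ne', hi]
    have hpos := Real.log_pos (one_lt_mul_div hN (by omega : 1 ≤ i + 1) hδ0 hδ1)
    have hopt := sum_excessLoss_eq (x := x) (r := r) (a := a)
      (predictorAt oracle τ x r a t ω : X → A → unitInterval) (fStar : X → A → unitInterval)
      (epochStart τ t) ω
    have hmin := horacle.isMin (epochStart τ t) (fun i => observed x r a ω i) fStar fStar.2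
    rw [← state_predictor oracle (observed x r a ω) hτ t] at hmin
    have hneg : ∑ s ∈ Finset.range (i + 1),
        excessLoss (predictorAt oracle τ x r a t ω : X → A → unitInterval)
          (fStar : X → A → unitInterval) (x s ω, r s ω) (a s ω) ≤ 0 := by
      rw [← hi, hopt]
      exact sub_nonpos.2 hmin
    have hsum : runSum oracle τ x r a
        (errorIncrement D fStar pol τ δ (predictorAt oracle τ x r a t ω)) (i + 1) ω =
        -((∑ s ∈ Finset.range (i + 1),
          excessLoss (predictorAt oracle τ x r a t ω : X → A → unitInterval)
            (fStar : X → A → unitInterval) (x s ω, r s ω) (a s ω)) / 8) +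
        (∑ s ∈ Finset.range (i + 1), roundError D fStar pol τ δ (predictorAt oracle τ x r a t ω) s
          (predictorAt oracle τ x r a s ω)) / 16 := by
      rw [runSum, Finset.sum_div, Finset.sum_div, ← Finset.sum_neg_distrib,
        ← Finset.sum_add_distrib]
      rfl
    rw [hsum] at hg
    have hfinal : ∑ s ∈ Finset.range (i + 1), roundError D fStar pol τ δ
        (predictorAt oracle τ x r a t ω) s (predictorAt oracle τ x r a s ω) ≤
        48 * Real.log (F.card * (i + 1 : ℕ) / δ) := by linarith
    refine le_trans hfinal ?_
    have hK0 : (0 : ℝ) < Fintype.card A := by exact_mod_cast hK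
    have hi0 : (0 : ℝ) < (i + 1 : ℕ) := by positivity
    generalize Real.log (F.card * (i + 1 : ℕ) / δ) = l at hpos ⊢
    -- The factor `1 / 30` in the rate allows a total error of `900 / 16 · log = 56.25 · log`; the
    -- supermartingale gives `16 · 3 = 48`.
    have e : (Fintype.card A : ℝ) * (i + 1 : ℕ) /
        (16 * (Fintype.card A * (i + 1 : ℕ) / (900 * l))) = 900 / 16 * l := by
      field_simp
    rw [e]
    linarith

/-- The first epoch costs at most 1 in each of its at most `B` rounds. Later rounds cost `3 · 30 ·
√2 · √(K log / (t + 1))`, and `∑ 1 / √(t + 1) ≤ 2 √T`, so `180 √2 ≤ 270` suffices. -/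
theorem sum_roundRegret_le (horacle : IsLeastSquaresOracle F oracle) (hτ : IsEpochSchedule τ)
    (hpol : IsGreedyPolicy F pol) (hF : ∀ f ∈ F, ∀ b : A, Measurable fun x => f x b)
    (hdouble : ∀ m, 1 < m → τ m ≤ 2 * τ (m - 1)) {B : ℕ} (hB : τ 1 ≤ B)
    (hδ0 : 0 < δ) (hδ1 : δ < 1) {T : ℕ} {ω : Ω}
    (hgood : ∀ i < T, ∀ g : F, runSum oracle τ x r a (errorIncrement D fStar pol τ δ g) (i + 1) ω ≤
      Real.log (1 / (δ / (2 * F.card * (i + 1 : ℕ) * ((i + 1 : ℕ) + 1))))) :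
    ∑ t ∈ Finset.range T, roundRegret D fStar pol τ δ t (predictorAt oracle τ x r a t ω) ≤
      B + 270 * √((Fintype.card A : ℝ) * T * Real.log (F.card * T / δ)) := by
  have hN : 1 ≤ F.card := Finset.card_pos.2 ⟨fStar, fStar.2⟩
  have hK : 1 ≤ Fintype.card A := Fintype.card_pos_iff.2 ⟨a 0 ω⟩
  set S := √(2 * (Fintype.card A * Real.log (F.card * T / δ))) with hS
  have hS0 : 0 ≤ S := Real.sqrt_nonneg _
  have hterm : ∀ t ∈ Finset.range T,
      roundRegret D fStar pol τ δ t (predictorAt oracle τ x r a t ω) ≤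
        (if t < B then 1 else 0) + 90 * S * (1 / √((t : ℝ) + 1)) := by
    intro t ht
    have ht' := Finset.mem_range.1 ht
    have hpos : 0 ≤ 90 * S * (1 / √((t : ℝ) + 1)) := by positivity
    by_cases h0 : epochStart τ t = 0
    · have htB : t < B := by
        have := (epochStart_le_lt hτ t).2
        rw [(epochStart_eq_zero_iff hτ t).1 h0] at this
        omega
      rw [if_pos htB]
      have := policyRegret_le_one (ν := D) (hpol.isGreedy hF fStar)
        (isStochasticPolicy_roundPolicy hpol hF τ δ t (predictorAt oracle τ x r a t ω))
      unfold roundRegret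
      linarith
    · have h1 := roundRegret_le horacle hτ hpol hF hδ0 hδ1 hgood ht'
      have h2 := card_div_learningRate_le hτ hdouble hK hN hδ0 hδ1 ht' h0
      have h3 : (0 : ℝ) ≤ if t < B then 1 else 0 := by split_ifs <;> norm_num
      rw [← hS] at h2
      linarith
  refine (Finset.sum_le_sum hterm).trans ?_
  rw [Finset.sum_add_distrib, ← Finset.mul_sum]
  have h1 : ∑ t ∈ Finset.range T, (if t < B then (1 : ℝ) else 0) ≤ B := by
    rw [← Finset.sum_filter, Finset.sum_const, nsmul_eq_mul, mul_one]
    have : ((Finset.range T).filter (· < B)).card ≤ (Finset.range B).card :=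
      Finset.card_le_card fun t ht => Finset.mem_range.2 (Finset.mem_filter.1 ht).2
    rw [Finset.card_range] at this
    exact_mod_cast this
  have h2 : 90 * S * ∑ t ∈ Finset.range T, 1 / √((t : ℝ) + 1) ≤
      270 * √((Fintype.card A : ℝ) * T * Real.log (F.card * T / δ)) := by
    have h3 := mul_le_mul_of_nonneg_left (sum_one_div_sqrt_le T) (by positivity : 0 ≤ 90 * S)
    have h4 : S * √T = √2 * √((Fintype.card A : ℝ) * T * Real.log (F.card * T / δ)) := by
      rw [hS, ← Real.sqrt_mul' _ (Nat.cast_nonneg T), ← Real.sqrt_mul (by norm_num : (0 : ℝ) ≤ 2)]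
      congr 1; ring
    have h5 : √2 ≤ 3 / 2 := by
      rw [Real.sqrt_le_left (by norm_num)]; norm_num
    have h6 := mul_le_mul_of_nonneg_right h5
      (Real.sqrt_nonneg ((Fintype.card A : ℝ) * T * Real.log (F.card * T / δ)))
    linarith
  linarith

/-- The regret bound, except in the case of one predictor and one round. -/
theorem IsRun.measureReal_regret_gt_le (hrun : IsRun oracle pol τ δ D P x r a)
    (horacle : IsLeastSquaresOracle F oracle) (hτ : IsEpochSchedule τ)
    (hpol : IsGreedyPolicy F pol) (hF : ∀ f ∈ F, ∀ b : A, Measurable fun x => f x b)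
    (hfs : Realizes D (fStar : X → A → unitInterval))
    (hdouble : ∀ m, 1 < m → τ m ≤ 2 * τ (m - 1)) {B : ℕ} (hB : τ 1 ≤ B)
    (hδ0 : 0 < δ) (hδ1 : δ < 1) {T : ℕ} (hT : 1 ≤ T) (hNT : 2 ≤ F.card * T) :
    P.real {ω | (2 * B + 300) * √((Fintype.card A : ℝ) * T * Real.log (F.card * T / δ)) <
      regret (pol fStar) x r a T ω} ≤ δ := by
  obtain ⟨ω₀⟩ : Nonempty Ω := nonempty_of_isProbabilityMeasure P
  have hK : (1 : ℝ) ≤ Fintype.card A := by exact_mod_cast Fintype.card_pos_iff.2 ⟨a 0 ω₀⟩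
  have hN : 1 ≤ F.card := Finset.card_pos.2 ⟨fStar, fStar.2⟩
  have hN0 : (0 : ℝ) < F.card := by exact_mod_cast hN
  have hT0 : (1 : ℝ) ≤ T := by exact_mod_cast hT
  have hNT' : (2 : ℝ) ≤ F.card * T := by exact_mod_cast hNT
  set L := Real.log (F.card * T / δ) with hL
  set M := √((Fintype.card A : ℝ) * T * L) with hM
  have hlog2 : Real.log (1 / (δ / 2)) ≤ L := by
    rw [one_div_div]
    exact Real.log_le_log (by positivity) (by gcongr)
  have hLhalf : 1 / 2 ≤ L := by
    have : Real.log 2 ≤ L := by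
      refine Real.log_le_log (by norm_num) ?_
      rw [le_div_iff₀ hδ0]; nlinarith
    linarith [Real.log_two_gt_d9]
  have hTL : √(T * L) ≤ M := by
    apply Real.sqrt_le_sqrt
    have : (0 : ℝ) ≤ T * L := by positivity
    nlinarith
  -- This lets the additive `B` be absorbed into `2 B M`.
  have hMhalf : 1 ≤ 2 * M := by
    have : √(1 / 4) ≤ √(T * L) := Real.sqrt_le_sqrt (by nlinarith)
    rw [show (1 / 4 : ℝ) = (1 / 2) ^ 2 by norm_num, Real.sqrt_sq (by norm_num)] at this
    linarith
  have hB0 : (0 : ℝ) ≤ B := Nat.cast_nonneg B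
  -- For small `T` the trivial bound `T ≤ 2 √(T L)` suffices. Otherwise `l = √(L / T)` is at most `1
  -- / 2`, and it balances `L / l` against `4 l T`.
  by_cases hbig : (T : ℝ) < 4 * L
  · have hempty : {ω | (2 * B + 300) * M < regret (pol fStar) x r a T ω} = ∅ := by
      refine Set.eq_empty_of_forall_notMem fun ω hω => ?_
      have h1 := (le_abs_self _).trans (abs_regret_le (pol fStar) x r a T ω)
      have h2 : (T : ℝ) ≤ 2 * √(T * L) := by
        have : √((T / 2) ^ 2) ≤ √(T * L) := Real.sqrt_le_sqrt (by nlinarith)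
        rw [Real.sqrt_sq (by positivity)] at this
        linarith
      have h3 : (2 * B + 300) * M < regret (pol fStar) x r a T ω := hω
      nlinarith
    rw [hempty, measureReal_empty]
    exact hδ0.le
  push Not at hbig
  set l := √(L / T) with hl
  have hLT : L / T ≤ (1 / 2) ^ 2 := by rw [div_le_iff₀ (by linarith)]; linarith
  have hl2 : l ≤ 1 / 2 := by
    rw [hl, ← Real.sqrt_sq (by norm_num : (0 : ℝ) ≤ 1 / 2)]
    exact Real.sqrt_le_sqrt hLT
  have hl0 : 0 < l := Real.sqrt_pos.2 (by positivity)
  have hlsq : l ^ 2 * T = L := by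
    rw [hl, Real.sq_sqrt (by positivity)]; field_simp
  have hlT : l * T = √(T * L) := by
    symm
    rw [Real.sqrt_eq_iff_eq_sq (by positivity) (by positivity)]
    rw [← hlsq]; ring
  -- The fitted predictor depends on the data, so every `g` is controlled at every sample size `n =
  -- i + 1`. The levels `δ / (2 N n (n + 1))` sum to at most `δ / 2`.
  let bad1 : ℕ → F → Set Ω := fun i g =>
    {ω | Real.log (1 / (δ / (2 * F.card * (i + 1 : ℕ) * ((i + 1 : ℕ) + 1)))) <
      runSum oracle τ x r a (errorIncrement D fStar pol τ δ g) (i + 1) ω}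
  let bad2 : Set Ω := {ω | Real.log (1 / (δ / 2)) <
    runSum oracle τ x r a (regretIncrement D fStar pol τ δ l) T ω}
  have hsub : {ω | (2 * B + 300) * M < regret (pol fStar) x r a T ω} ⊆
      (⋃ i ∈ Finset.range T, ⋃ g : F, bad1 i g) ∪ bad2 := by
    intro ω hω
    by_contra hnot
    simp only [Set.mem_union, Set.mem_iUnion, not_or, not_exists] at hnot
    have hgood : ∀ i < T, ∀ g : F,
        runSum oracle τ x r a (errorIncrement D fStar pol τ δ g) (i + 1) ω ≤
        Real.log (1 / (δ / (2 * F.card * (i + 1 : ℕ) * ((i + 1 : ℕ) + 1)))) :=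
      fun i hi g => not_lt.1 (hnot.1 i (Finset.mem_range.2 hi) g)
    have h1 := sum_roundRegret_le horacle hτ hpol hF hdouble hB hδ0 hδ1 hgood
    have h2 : runSum oracle τ x r a (regretIncrement D fStar pol τ δ l) T ω ≤
        Real.log (1 / (δ / 2)) := not_lt.1 hnot.2
    have h3 : runSum oracle τ x r a (regretIncrement D fStar pol τ δ l) T ω =
        l * (regret (pol fStar) x r a T ω - ∑ t ∈ Finset.range T,
          roundRegret D fStar pol τ δ t (predictorAt oracle τ x r a t ω)) - 4 * (l ^ 2 * T) := by
      have : 4 * (l ^ 2 * T) = ∑ t ∈ Finset.range T, 4 * l ^ 2 := by simp; ring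
      rw [this, runSum, regret, ← Finset.sum_sub_distrib, Finset.mul_sum,
        ← Finset.sum_sub_distrib]
      rfl
    rw [h3, hlsq] at h2
    have h4 : l * (regret (pol fStar) x r a T ω - ∑ t ∈ Finset.range T,
        roundRegret D fStar pol τ δ t (predictorAt oracle τ x r a t ω)) ≤ l * (5 * (l * T)) := by
      have : l * (5 * (l * T)) = 5 * L := by rw [← hlsq]; ring
      linarith
    have h5 := le_of_mul_le_mul_left h4 hl0
    rw [hlT] at h5
    have h6 : (2 * B + 300) * M < regret (pol fStar) x r a T ω := hω
    nlinarith
  refine (measureReal_mono hsub).trans ((measureReal_union_le _ _).trans ?_)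
  have hb2 : P.real bad2 ≤ δ / 2 :=
    hrun.measureReal_regretIncrement_le horacle hτ hpol hF hfs hl0.le hl2 T (by positivity)
  have hb1 : P.real (⋃ i ∈ Finset.range T, ⋃ g : F, bad1 i g) ≤ δ / 2 := by
    refine (measureReal_biUnion_finset_le _ _).trans ?_
    calc _ ≤ ∑ i ∈ Finset.range T, δ / 2 * (1 / (((i + 1 : ℕ) : ℝ) * ((i + 1 : ℕ) + 1))) := by
          refine Finset.sum_le_sum fun i _ => (measureReal_iUnion_fintype_le _).trans ?_
          refine (Finset.sum_le_card_nsmul _ _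
            (δ / (2 * F.card * (i + 1 : ℕ) * ((i + 1 : ℕ) + 1))) fun g _ =>
            hrun.measureReal_errorIncrement_le horacle hτ hpol hF hfs g (i + 1)
              (by positivity)).trans_eq ?_
          rw [nsmul_eq_mul, Finset.card_univ, Fintype.card_coe]
          field_simp
      _ = δ / 2 * ∑ i ∈ Finset.range T, 1 / (((i + 1 : ℕ) : ℝ) * ((i + 1 : ℕ) + 1)) := by
          rw [Finset.mul_sum]
      _ ≤ δ / 2 * 1 := by
          have := sum_one_div_mul_le T
          gcongr
      _ = δ / 2 := mul_one _
  linarith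

/-- With a single predictor, the first action is optimal with probability at least `1 / K`. -/
theorem IsRun.inv_card_le_measureReal_greedy (hrun : IsRun oracle pol τ δ D P x r a)
    (horacle : IsLeastSquaresOracle F oracle) (hτ : IsEpochSchedule τ)
    (hpol : IsGreedyPolicy F pol) (hF : ∀ f ∈ F, ∀ b : A, Measurable fun x => f x b)
    (hN : F.card = 1) :
    1 / (Fintype.card A : ℝ) ≤ P.real {ω | a 0 ω = pol fStar (x 0 ω)} := by
  have hpred : ∀ ω, predictorAt oracle τ x r a 0 ω = fStar := fun ω =>
    Subtype.ext (Finset.card_le_one.1 hN.le _ (Subtype.property _) _ fStar.2)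
  have hgr := hpol.isGreedy hF fStar
  have hpt := isStochasticPolicy_pointPolicy hgr.measurable
  have h1 := hrun.integral_mul_indicator horacle hτ hpol hF 0 fStar (Y := fun _ => 1)
    measurable_const (c := 1) (by simp) hpt.measurable (c' := 1) (fun z b => by
      rw [abs_of_nonneg (hpt.nonneg z b)]; exact hpt.le_one z b)
  have hset : {ω | predictorAt oracle τ x r a 0 ω = fStar} = Set.univ :=
    Set.eq_univ_of_forall hpred
  rw [hset] at h1
  simp only [Set.indicator_univ, one_mul, integral_const, probReal_univ, smul_eq_mul,
    mul_one] at h1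
  have hms : MeasurableSet {ω | a 0 ω = pol fStar (x 0 ω)} :=
    measurableSet_eq_fun (hrun.measurable_action 0)
      ((hpol.measurable fStar).comp (hrun.measurable_context 0))
  have h2 : ∫ ω, pointPolicy (fun z : X × (A → unitInterval) => pol fStar z.1) (x 0 ω, r 0 ω)
      (a 0 ω) ∂P = P.real {ω | a 0 ω = pol fStar (x 0 ω)} := by
    rw [← integral_indicator_one hms]
    congr 1 with ω
    classical simp [pointPolicy, Set.indicator_apply]
  rw [← h2, h1]
  have hq := isStochasticPolicy_roundPolicy hpol hF τ δ 0 fStar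
  calc 1 / (Fintype.card A : ℝ) = ∫ _, 1 / (Fintype.card A : ℝ) ∂D := by simp
    _ ≤ _ := by
      refine integral_mono (integrable_const _) (integrable_sum_mul hq hpt.measurable 1
        fun z b => by rw [abs_of_nonneg (hpt.nonneg z b)]; exact hpt.le_one z b) fun z => ?_
      simp only [pointPolicy, mul_ite, mul_one, mul_zero, Finset.sum_ite_eq', Finset.mem_univ,
        if_true]
      exact inv_card_le_selectProb_self (learningRate_nonneg _ _ _ _ _) (hpol.isMax fStar z.1)

theorem IsRun.le_measureReal_regret_le (hrun : IsRun oracle pol τ δ D P x r a)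
    (horacle : IsLeastSquaresOracle F oracle) (hτ : IsEpochSchedule τ)
    (hpol : IsGreedyPolicy F pol) (hF : ∀ f ∈ F, ∀ b : A, Measurable fun x => f x b)
    (hfs : Realizes D (fStar : X → A → unitInterval))
    (hdouble : ∀ m, 1 < m → τ m ≤ 2 * τ (m - 1)) {B : ℕ} (hB : τ 1 ≤ B)
    (hδ0 : 0 < δ) (hδ1 : δ < 1) {T : ℕ} (hT : 1 ≤ T) :
    1 - δ ≤ P.real {ω | regret (pol fStar) x r a T ω ≤
      (2 * B + 300) * √((Fintype.card A : ℝ) * T * Real.log (F.card * T / δ))} := by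
  have hN : 1 ≤ F.card := Finset.card_pos.2 ⟨fStar, fStar.2⟩
  by_cases hNT : 2 ≤ F.card * T
  · have h1 := hrun.measureReal_regret_gt_le horacle hτ hpol hF hfs hdouble hB hδ0 hδ1 hT hNT
    have h2 := measureReal_union_le (μ := P) {ω | regret (pol fStar) x r a T ω ≤
        (2 * B + 300) * √((Fintype.card A : ℝ) * T * Real.log (F.card * T / δ))}
      {ω | (2 * B + 300) * √((Fintype.card A : ℝ) * T * Real.log (F.card * T / δ)) <
        regret (pol fStar) x r a T ω}
    have h3 : {ω | regret (pol fStar) x r a T ω ≤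
        (2 * B + 300) * √((Fintype.card A : ℝ) * T * Real.log (F.card * T / δ))} ∪
      {ω | (2 * B + 300) * √((Fintype.card A : ℝ) * T * Real.log (F.card * T / δ)) <
        regret (pol fStar) x r a T ω} = Set.univ := Set.eq_univ_of_forall fun ω => by
        simp only [Set.mem_union, Set.mem_ofPred_eq]
        exact le_or_gt _ _
    rw [h3, probReal_univ] at h2
    linarith
  have hT1 : T = 1 := by nlinarith
  have hN1 : F.card = 1 := by nlinarith
  obtain ⟨ω₀⟩ : Nonempty Ω := nonempty_of_isProbabilityMeasure P
  have hK : (0 : ℝ) < Fintype.card A := by exact_mod_cast Fintype.card_pos_iff.2 ⟨a 0 ω₀⟩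
  have hB0 : (0 : ℝ) ≤ B := Nat.cast_nonneg B
  subst hT1
  -- One predictor and one round. If `1 / K ≤ 1 - δ`, then `K log (1 / δ) ≥ K (1 - δ) ≥ 1` and the
  -- bound exceeds the trivial one. Otherwise zero regret already has probability at least `1 / K >
  -- 1 - δ`.
  by_cases hsmall : 1 / (Fintype.card A : ℝ) ≤ 1 - δ
  · have huniv : {ω | regret (pol fStar) x r a 1 ω ≤ (2 * B + 300) *
        √((Fintype.card A : ℝ) * (1 : ℕ) * Real.log (F.card * (1 : ℕ) / δ))} = Set.univ := by
      refine Set.eq_univ_of_forall fun ω => ?_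
      have h1 := (le_abs_self _).trans (abs_regret_le (pol fStar) x r a 1 ω)
      have h2 : 1 - δ ≤ Real.log (1 / δ) := by
        rw [one_div, Real.log_inv]
        linarith [Real.log_le_sub_one_of_pos hδ0]
      have h3 : √1 ≤ √((Fintype.card A : ℝ) * (1 : ℕ) * Real.log (F.card * (1 : ℕ) / δ)) := by
        apply Real.sqrt_le_sqrt
        rw [hN1]
        push_cast
        rw [mul_one, mul_one]
        rw [div_le_iff₀ hK] at hsmall
        nlinarith
      rw [Real.sqrt_one] at h3
      change regret (pol fStar) x r a 1 ω ≤ _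
      push_cast at h1 h3 ⊢
      nlinarith
    rw [huniv, probReal_univ]
    linarith
  · refine (not_le.1 hsmall).le.trans ((hrun.inv_card_le_measureReal_greedy (fStar := fStar)
      horacle hτ hpol hF hN1).trans (measureReal_mono fun ω hω => ?_))
    have h0 : a 0 ω = pol fStar (x 0 ω) := hω
    have h1 : regret (pol fStar) x r a 1 ω = 0 := by simp [regret, h0]
    change regret (pol fStar) x r a 1 ω ≤ _
    rw [h1]
    positivity

end Main

end Falcon

end

theorem theorem1 :
    -- the regret bound, with a constant that depends only on the bound `B` on `τ₁`
    (∀ B : ℕ, ∃ C : ℝ, 0 < C ∧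
      ∀ (X : Type*) [MeasurableSpace X]
        (A : Type*) [Fintype A] [DecidableEq A] [MeasurableSpace A] [MeasurableSingletonClass A]
        (F : Finset (X → A → unitInterval)) (_ : ∀ f ∈ F, ∀ b : A, Measurable fun x => f x b)
        (oracle : (n : ℕ) → (Fin n → Falcon.Datum X A) → F)
        (_ : Falcon.IsLeastSquaresOracle F oracle)
        (pol : F → X → A) (_ : Falcon.IsGreedyPolicy F pol)
        (D : Measure (X × (A → unitInterval))) [IsProbabilityMeasure D]
        (fStar : F) (_ : Falcon.Realizes D (fStar : X → A → unitInterval))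
        (τ : ℕ → ℕ) (_ : Falcon.IsEpochSchedule τ)
        (_ : ∀ m : ℕ, 1 < m → τ m ≤ 2 * τ (m - 1)) (_ : τ 1 ≤ B)
        (δ : ℝ) (_ : 0 < δ) (_ : δ < 1)
        (Ω : Type*) [MeasurableSpace Ω] (P : Measure Ω) [IsProbabilityMeasure P]
        (x : ℕ → Ω → X) (r : ℕ → Ω → A → unitInterval) (a : ℕ → Ω → A)
        (_ : Falcon.IsRun oracle pol τ δ D P x r a)
        (T : ℕ) (_ : 1 ≤ T),
        1 - δ ≤ P.real {ω | Falcon.regret (pol fStar) x r a T ω ≤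
          C * √((Fintype.card A : ℝ) * T * Real.log ((F.card : ℝ) * T / δ))}) ∧
    -- one oracle call per epoch: the number of calls over `T` rounds is the number of epochs begun
    (∀ (X A : Type*) (F : Finset (X → A → unitInterval))
        (oracle : (n : ℕ) → (Fin n → Falcon.Datum X A) → F)
        (τ : ℕ → ℕ) (_ : Falcon.IsEpochSchedule τ) (d : ℕ → Falcon.Datum X A)
        (T : ℕ) (_ : 1 ≤ T),
        IsLeast {m : ℕ | T ≤ τ m} (Falcon.oracleCalls oracle τ d T)) ∧
    -- the schedule `τ_m = 2 ^ m` is admissible and leads to `O(log T)` oracle calls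
    (Falcon.IsEpochSchedule Falcon.doublingSchedule ∧
      (∀ m : ℕ, 1 < m → Falcon.doublingSchedule m ≤ 2 * Falcon.doublingSchedule (m - 1)) ∧
      ∃ C : ℝ, 0 < C ∧
        ∀ (X A : Type*) (F : Finset (X → A → unitInterval))
          (oracle : (n : ℕ) → (Fin n → Falcon.Datum X A) → F)
          (d : ℕ → Falcon.Datum X A) (T : ℕ) (_ : 2 ≤ T),
          (Falcon.oracleCalls oracle Falcon.doublingSchedule d T : ℝ) ≤ C * Real.log T) := by
  refine ⟨fun B => ⟨2 * B + 300, by positivity, ?_⟩, ?_, ?_⟩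
  · intro X _ A _ _ _ _ F hF oracle horacle pol hpol D _ fStar hfs τ hτ hdouble hB δ hδ0 hδ1 Ω _ P _
      x r a hrun T hT
    exact hrun.le_measureReal_regret_le horacle hτ hpol hF hfs hdouble hB hδ0 hδ1 hT
  · intro X A F oracle τ hτ d T hT
    exact Falcon.isLeast_oracleCalls oracle d hτ hT
  · refine ⟨Falcon.isEpochSchedule_doublingSchedule, fun m hm => Falcon.doublingSchedule_le hm,
      2 / Real.log 2, div_pos two_pos (Real.log_pos one_lt_two), ?_⟩
    intro X A F oracle d T hT
    exact Falcon.oracleCalls_doublingSchedule_le oracle d hT
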